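/- All registers are finite-dimensional. For a linear map $\Psi$ on operators let $\|\Psi\|_\diamond=\sup_\rho\|(\mathbb I_E\otimes\Psi)(\rho)\|_{\mathrm{tr}}$, the supremum being over all environments $E$ and density operators $\rho$; the diamond-norm distance of $\Psi,\Psi'$ is $\frac12\|\Psi-\Psi'\|_\diamond$. A channel is a completely positive (CP) trace-preserving map. $|\bot\rangle$ is an extra basis state of a decrypted message register, signifying rejection. Expectations over keys are uniform. **Codes.** Let $\mathcal K_0$ be a finite non-empty set and $\{V_{k_0}\}_{k_0\in\mathcal K_0}$ unitaries on a message register $M$ of $m$ qubits and a tag register $T$ of $t$ qubits, such that for all $k_0$ and every Pauli $P_\ell$ on $m+t$ qubits, $P_\ell V_{k_0}=e^{i\theta}V_{k_0}P_{\ell'}$ for some $\ell',\theta$. The family is strong purity testing with error $\delta$ if for every Pauli $P_\ell\neq\mathsf I$, $\Pr_{k_0}[V_{k_0}^\dagger P_\ell V_{k_0}\in\mathbb P_m\otimes\{\mathsf I,\mathsf Z\}^{\otimes t}]\le\delta$ (Paulis up to phase). **Scheme.** With key $k=(k_0,k_1)$, $k_1\in\{0,1\}^{2(m+t)}$, put $U_k=P_{k_1}V_{k_0}$,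 and let $$\mathsf{Encrypt}_{k}(\rho)=U_k(\rho\otimes|0^t\rangle\langle0^t|)U_k^\dagger,\qquad \mathsf{Decrypt}_k(\rho)=\langle0^t|U_k^\dagger\rho U_k|0^t\rangle+|\bot\rangle\langle\bot|\otimes\mathrm{Tr}_M\sum_{i\ne0^t}\langle i|U_k^\dagger\rho U_k|i\rangle .$$ **$\epsilon$-$\mathsf{QCA\text{-}R}$** (with recycling function $f(k_0,k_1)=k_0$). For a channel $\mathcal A$ on $MT$ and side information, taking the side-information register $R$ to $R'$, define $$\mathcal S_{\mathsf{acc}}[\mathcal A](\rho^R)=\mathbb E_k\,\langle0^t|\langle\Phi^+|U_k^\dagger\,\mathcal A^{MTR}\big(U_k(\rho\otimes|\Phi^+\rangle\langle\Phi^+|^{M\hat M}\otimes|0^t\rangle\langle0^t|)U_k^\dagger\big)U_k|0^t\rangle|\Phi^+\rangle ,$$ where $|\Phi^+\rangle$ is the maximally entangled state of $M$ and a copy $\hat M$, and $U_k$ acts on $MT$. A CP map $\mathcal S_{\mathsf{rej}}$ from $R$ to $R'$ is an $\epsilon$-good rejecting simulator for $\mathcal A$ if $\mathcal S_{\mathsf{acc}}[\mathcal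 A]+\mathcal S_{\mathsf{rej}}$ is trace preserving and the channel $$\rho^{MR}\mapsto\mathbb E_k\big[\mathrm{Proj}_{acc}(\omega_k)\otimes|k\rangle\langle k|+\mathrm{Proj}_{rej}(\omega_k)\otimes|k_0\rangle\langle k_0|\big],\qquad \omega_k=\mathsf{Decrypt}_k\circ\mathcal A\circ\mathsf{Encrypt}_k(\rho),$$ is within diamond-norm distance $\epsilon$ of $$\mathbb I^M\otimes\mathcal S_{\mathsf{acc}}[\mathcal A]\otimes\mathbb E_k[|k\rangle\langle k|]+|\bot\rangle\langle\bot|\,\mathrm{Tr}_M\otimes\mathcal S_{\mathsf{rej}}\otimes\mathbb E_{k_0}[|k_0\rangle\langle k_0|].$$ Here $\mathrm{Proj}_{acc}$ and $\mathrm{Proj}_{rej}$ are conjugation of the message register with $\mathbb I-|\bot\rangle\langle\bot|$ and with $|\bot\rangle\langle\bot|$. The scheme is $\epsilon$-$\mathsf{QCA\text{-}R}$ if every channel $\mathcal A$ (for all $R,R'$) has an $\epsilon$-good rejecting simulator. **Theorem.** Let $\{V_{k_0}\}$ be a strong-purity-testing code (with some error $\delta$) such that the scheme above is $\epsilon$-$\mathsf{QCA\text{-}R}$.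 Let $C_i=M_iT_i$ ($i=1,2$) be the ciphertext registers of two messages $M_1,M_2$, and let $\mathcal A_1:C_1C_2R\to C_1C_2R_1$ be a channel. Then there is an $\epsilon$-good rejecting simulator $\mathcal S^1_{\mathsf{rej}}$ for $\mathcal A_1$, regarded as an adversary on $C_1$ with side information $C_2R$, such that the following holds for every channel $\mathcal A_2:M_1C_2R_1\to C_2R_2$ (where $M_1$ is the decrypted first message, possibly $\bot$). Let $$\mathrm{Real}_{k_0,k_1,k_2}=\mathsf{Decrypt}^{C_2\to M_2}_{k_0,k_2}\circ\mathcal A_2\circ\mathsf{Decrypt}^{C_1\to M_1}_{k_0,k_1}\circ\mathcal A_1\circ\big(\mathsf{Encrypt}^{M_1\to C_1}_{k_0,k_1}\otimes\mathsf{Encrypt}^{M_2\to C_2}_{k_0,k_2}\big),$$ $$\mathfrak R(\rho^{M_1M_2R})=\mathbb E_{k_0,k_1,k_2}\big[\mathrm{Proj}^{M_2}_{acc}(\mathrm{Real}_{k_0,k_1,k_2}(\rho))\otimes|k_0,k_2\rangle\langle k_0,k_2|+\mathrm{Proj}^{M_2}_{rej}(\mathrm{Real}_{k_0,k_1,k_2}(\rho))\otimes|k_0\rangle\langle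 k_0|\big],$$ and let $\mathcal A_2'=\mathcal A_2\circ\big(\mathbb I^{M_1}\otimes\mathcal S_{\mathsf{acc}}[\mathcal A_1]+|\bot\rangle\langle\bot|^{M_1}\mathrm{Tr}_{M_1}\otimes\mathcal S^1_{\mathsf{rej}}\big)$, an adversary on $C_2$ with side information $M_1R$ before and $R_2$ after. Then there is a CP map $\mathcal S_{\mathsf{rej}}:M_1R\to R_2$ such that, with $\mathcal S_{\mathsf{acc}}=\mathcal S_{\mathsf{acc}}[\mathcal A_2']$, the map $\mathcal S_{\mathsf{acc}}+\mathcal S_{\mathsf{rej}}$ is trace preserving and $\mathfrak R$ is within diamond-norm distance $2\epsilon$ of $$\mathfrak I=\mathbb I^{M_2}\otimes\mathcal S_{\mathsf{acc}}\otimes\mathbb E_{k_0,k_2}[|k_0,k_2\rangle\langle k_0,k_2|]+|\bot\rangle\langle\bot|^{M_2}\,\mathrm{Tr}_{M_2}\otimes\mathcal S_{\mathsf{rej}}\otimes\mathbb E_{k_0}[|k_0\rangle\langle k_0|].$$ -/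

import Mathlib

open scoped Matrix Kronecker ENNReal NNReal

noncomputable section

namespace QAuth

/-! ### Superoperators on finite registers

A register is a finite type, its elements label the computational basis; operators on a register
are square complex matrices, and composite registers are product types. -/

/-- Linear maps from operators on the register `A` to operators on the register `B`. -/
abbrev SuperOp (A B : Type) : Type := Matrix A A ℂ →ₗ[ℂ] Matrix B B ℂ

namespace SuperOp

variable {A B C D : Type}

/-- `id_E ⊗ Φ`: the map `Φ` acts on the second tensor factor. -/
def idTensor (E : Type) (Φ : SuperOp A B) : SuperOp (E × A) (E × B) where
  toFun X := Matrix.of fun i j => Φ (Matrix.of fun a a' => X (i.1, a) (j.1, a')) i.2 j.2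
  map_add' X Y := by
    ext i j
    exact congrFun (congrFun (Φ.map_add (Matrix.of fun a a' => X (i.1, a) (j.1, a'))
      (Matrix.of fun a a' => Y (i.1, a) (j.1, a'))) i.2) j.2
  map_smul' c X := by
    ext i j
    exact congrFun (congrFun
      (Φ.map_smul c (Matrix.of fun a a' => X (i.1, a) (j.1, a'))) i.2) j.2

/-- `Φ ⊗ id_E`: the map `Φ` acts on the first tensor factor. -/
def tensorId (Φ : SuperOp A B) (E : Type) : SuperOp (A × E) (B × E) where
  toFun X := Matrix.of fun i j => Φ (Matrix.of fun a a' => X (a, i.2) (a', j.2)) i.1 j.1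
  map_add' X Y := by
    ext i j
    exact congrFun (congrFun (Φ.map_add (Matrix.of fun a a' => X (a, i.2) (a', j.2))
      (Matrix.of fun a a' => Y (a, i.2) (a', j.2))) i.1) j.1
  map_smul' c X := by
    ext i j
    exact congrFun (congrFun
      (Φ.map_smul c (Matrix.of fun a a' => X (a, i.2) (a', j.2))) i.1) j.1

/-- The tensor product `Φ ⊗ Ψ` of two superoperators. -/
def tensor (Φ : SuperOp A B) (Ψ : SuperOp C D) : SuperOp (A × C) (B × D) :=
  (idTensor B Ψ).comp (tensorId Φ C)

/-- `X ↦ K X Kᴴ`. -/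
def conj [Fintype A] (K : Matrix B A ℂ) : SuperOp A B where
  toFun X := K * X * Kᴴ
  map_add' X Y := by simp [Matrix.mul_add, Matrix.add_mul]
  map_smul' c X := by simp

/-- Renaming of basis states along a bijection of registers. -/
def relabel (e : A ≃ B) : SuperOp A B := (Matrix.reindexLinearEquiv ℂ ℂ e e).toLinearMap

/-- `X ↦ X ⊗ σ`: a register in the (possibly unnormalized) state `σ` is appended. -/
def append (A : Type) (σ : Matrix B B ℂ) : SuperOp A (A × B) where
  toFun X := X ⊗ₖ σ
  map_add' X Y := Matrix.add_kronecker X Y σ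
  map_smul' c X := Matrix.smul_kronecker c X σ

/-- The partial trace over the second factor. -/
def traceRight (A B : Type) [Fintype B] : SuperOp (A × B) A where
  toFun X := Matrix.of fun a a' => ∑ b, X (a, b) (a', b)
  map_add' X Y := by ext a a'; simp [Finset.sum_add_distrib]
  map_smul' c X := by ext a a'; simp [Finset.mul_sum]

/-- `X ↦ tr(X) σ`: everything is discarded and replaced by `σ`. -/
def replace [Fintype A] (σ : Matrix B B ℂ) : SuperOp A B where
  toFun X := X.trace • σ
  map_add' X Y := by simp [Matrix.trace_add, add_smul]
  map_smul' c X := by simp [Matrix.trace_smul, mul_smul]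

/-- `ρ ↦ |v⟩⟨v| ⊗ ρ`. -/
def attach (v : B → ℂ) (A : Type) : SuperOp A (B × A) where
  toFun X := Matrix.vecMulVec v (star v) ⊗ₖ X
  map_add' X Y := Matrix.kronecker_add _ X Y
  map_smul' c X := Matrix.kronecker_smul c _ X

/-- `X ↦ ⟨v| X |v⟩`, where `v` is a vector of the first register. -/
def detach [Fintype B] (v : B → ℂ) (A : Type) : SuperOp (B × A) A where
  toFun X := Matrix.of fun a a' => ∑ b, ∑ b', star (v b) * X (b, a) (b', a') * v b'
  map_add' X Y := by
    ext a a'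
    simp [mul_add, add_mul, Finset.sum_add_distrib]
  map_smul' c X := by
    ext a a'
    simp only [Matrix.of_apply, Matrix.smul_apply, smul_eq_mul, RingHom.id_apply, Finset.mul_sum]
    exact Finset.sum_congr rfl fun b _ => Finset.sum_congr rfl fun b' _ => by ring

/-- Complete positivity: `id_E ⊗ Φ` preserves positive semidefinite operators, for every finite
register `E`. -/
def IsCP (Φ : SuperOp A B) : Prop :=
  open scoped ComplexOrder in
  ∀ (E : Type) [Fintype E] (X : Matrix (E × A) (E × A) ℂ),
    X.PosSemidef → (idTensor E Φ X).PosSemidef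

/-- Trace preservation. -/
def IsTP [Fintype A] [Fintype B] (Φ : SuperOp A B) : Prop :=
  ∀ X : Matrix A A ℂ, (Φ X).trace = X.trace

/-- Quantum channels. -/
def IsChannel [Fintype A] [Fintype B] (Φ : SuperOp A B) : Prop := Φ.IsCP ∧ Φ.IsTP

end SuperOp

open SuperOp

/-- Density operators. -/
def IsDensity {A : Type} [Fintype A] (ρ : Matrix A A ℂ) : Prop :=
  open scoped ComplexOrder in ρ.PosSemidef ∧ ρ.trace = 1

/-- The trace norm `tr √(Xᴴ X)`: the sum of the singular values. -/
def traceNorm {A : Type} [Fintype A] [DecidableEq A] (X : Matrix A A ℂ) : ℝ :=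
  ∑ i, Real.sqrt ((Matrix.isHermitian_conjTranspose_mul_self X).eigenvalues i)

/-- The diamond norm: the supremum of `‖(id_E ⊗ Φ)(ρ)‖_tr` over all finite environment registers
`E` and all density operators `ρ`. -/
def diamondNorm {A B : Type} [Fintype A] [Fintype B] [DecidableEq B] (Φ : SuperOp A B) : ℝ≥0∞ :=
  ⨆ (E : Type) (_ : Fintype E) (_ : DecidableEq E) (ρ : Matrix (E × A) (E × A) ℂ)
    (_ : IsDensity ρ), ENNReal.ofReal (traceNorm (idTensor E Φ ρ))

/-- The diamond-norm distance `½ ‖Φ - Ψ‖_⋄`. -/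
def diamondDist {A B : Type} [Fintype A] [Fintype B] [DecidableEq B] (Φ Ψ : SuperOp A B) : ℝ≥0∞ :=
  2⁻¹ * diamondNorm (Φ - Ψ)

/-! ### Accepting and rejecting

After decryption the message register carries one additional basis state `|⊥⟩ = |none⟩`. -/

/-- The projector `|⊥⟩⟨⊥|`. -/
def botState (M : Type) [DecidableEq M] : Matrix (Option M) (Option M) ℂ :=
  Matrix.single none none 1

/-- The inclusion of the operators on `M` into those on `M` extended by `|⊥⟩`. -/
def accEmbed (M : Type) [Fintype M] [DecidableEq M] : SuperOp M (Option M) :=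
  conj (Matrix.of fun (o : Option M) (a : M) => if o = some a then 1 else 0)

/-- `X ↦ tr(X) |⊥⟩⟨⊥|`. -/
def rejEmbed (M : Type) [Fintype M] [DecidableEq M] : SuperOp M (Option M) :=
  replace (botState M)

/-- `ρ ↦ (1 - |⊥⟩⟨⊥|) ρ (1 - |⊥⟩⟨⊥|)`. -/
def projAcc (M : Type) [Fintype M] [DecidableEq M] : SuperOp (Option M) (Option M) :=
  conj (1 - botState M)

/-- `ρ ↦ |⊥⟩⟨⊥| ρ |⊥⟩⟨⊥|`. -/
def projRej (M : Type) [Fintype M] [DecidableEq M] : SuperOp (Option M) (Option M) :=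
  conj (botState M)

/-- The maximally entangled state `|Φ⁺⟩ = |M|^(-1/2) ∑ₐ |a⟩|a⟩` of two copies of `M`; for a
register of `m` qubits, these are `m` EPR pairs. -/
def maxEntangled (M : Type) [Fintype M] [DecidableEq M] : M × M → ℂ :=
  fun ab => if ab.1 = ab.2 then ((Real.sqrt (Fintype.card M))⁻¹ : ℝ) else 0

/-! ### Quantum encryption schemes -/

/-- A secret-key quantum encryption scheme with key set `K`, message register `M` and tag register
`T`: unitaries `U k` on `M T`, and tag states `σ k = ∑ w, p k w |φ k w⟩⟨φ k w|` given through
a spectral decomposition, `w : W` being the randomness of the encryption. -/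
structure EncScheme (K M T W : Type) [Fintype M] [DecidableEq M] [Fintype T] [DecidableEq T]
    [Fintype W] [DecidableEq W] where
  U : K → Matrix.unitaryGroup (M × T) ℂ
  p : K → W → ℝ
  φ : K → W → T → ℂ
  p_nonneg : ∀ k w, 0 ≤ p k w
  p_sum : ∀ k, ∑ w, p k w = 1
  φ_orthonormal : ∀ k w w', star (φ k w) ⬝ᵥ φ k w' = if w = w' then 1 else 0

namespace EncScheme

variable {K M T W L : Type} [Fintype K] [DecidableEq K] [Fintype M] [DecidableEq M]
  [Fintype T] [DecidableEq T] [Fintype W] [DecidableEq W] [Fintype L] [DecidableEq L]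
  {R R' : Type} [Fintype R] [DecidableEq R] [Fintype R'] [DecidableEq R']

/-- The unitary of the key `k`, as a matrix. -/
def mat (S : EncScheme K M T W) (k : K) : Matrix (M × T) (M × T) ℂ := (S.U k).1

/-- The tag state `σ k`. -/
def tagState (S : EncScheme K M T W) (k : K) : Matrix T T ℂ :=
  ∑ w, (S.p k w : ℂ) • Matrix.vecMulVec (S.φ k w) (star (S.φ k w))

/-- The projector onto the support of the tag state `σ k`. -/
def tagProj (S : EncScheme K M T W) (k : K) : Matrix T T ℂ :=
  open Classical in
  ∑ w with S.p k w ≠ 0, Matrix.vecMulVec (S.φ k w) (star (S.φ k w))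

/-- `ρ ↦ U_k (ρ ⊗ σ_k) U_kᴴ`. -/
def encrypt (S : EncScheme K M T W) (k : K) : SuperOp M (M × T) :=
  (conj (S.mat k)).comp (append M (S.tagState k))

/-- The accepting part of decryption, `ρ ↦ tr_T (Π (U_kᴴ ρ U_k) Π)` with `Π` the projector onto
the support of the tag state. -/
def decryptAcc (S : EncScheme K M T W) (k : K) : SuperOp (M × T) (Option M) :=
  (accEmbed M).comp ((traceRight M T).comp
    ((conj ((1 : Matrix M M ℂ) ⊗ₖ S.tagProj k)).comp (conj (S.mat k)ᴴ)))

/-- The rejecting part of decryption, `ρ ↦ |⊥⟩⟨⊥| tr (Π' (U_kᴴ ρ U_k) Π')` with `Π'` the projector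
onto the complement of the support of the tag state. -/
def decryptRej (S : EncScheme K M T W) (k : K) : SuperOp (M × T) (Option M) :=
  (replace (botState M)).comp
    ((conj ((1 : Matrix M M ℂ) ⊗ₖ (1 - S.tagProj k))).comp (conj (S.mat k)ᴴ))

/-- Decryption. -/
def decrypt (S : EncScheme K M T W) (k : K) : SuperOp (M × T) (Option M) :=
  S.decryptAcc k + S.decryptRej k

/-- The real channel with key recycling, for an adversary `𝒜` on the ciphertext and on side
information: an average over uniform keys `k`, in which `k` is revealed on accept and `f k` on
reject. The revealed key is in the register `K ⊕ L`. -/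
def real (S : EncScheme K M T W) (f : K → L) (𝒜 : SuperOp ((M × T) × R) ((M × T) × R')) :
    SuperOp (M × R) ((Option M × R') × (K ⊕ L)) :=
  (Fintype.card K : ℂ)⁻¹ • ∑ k,
    ((append _ (Matrix.single (Sum.inl k) (Sum.inl k) 1)).comp
        ((tensorId (S.decryptAcc k) R').comp (𝒜.comp (tensorId (S.encrypt k) R))) +
      (append _ (Matrix.single (Sum.inr (f k)) (Sum.inr (f k)) 1)).comp
        ((tensorId (S.decryptRej k) R').comp (𝒜.comp (tensorId (S.encrypt k) R))))

/-- The vector `U_k^{M₁T} |Φ⁺⟩^{M₂M₁} |φ_{k,w}⟩^T` of `M₂ M₁ T`: an encrypted half of a maximally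
entangled state, under key `k` and randomness `w`. -/
def dummy (S : EncScheme K M T W) (k : K) (w : W) : M × (M × T) → ℂ :=
  fun x => ∑ y : M × T, S.mat k x.2 y * (maxEntangled M (x.1, y.1) * S.φ k w y.2)

/-- The accepting simulator
`ρ ↦ 𝔼_{k,w} ⟨φ_{k,w}|⟨Φ⁺| U_kᴴ 𝒜(U_k (ρ ⊗ |Φ⁺⟩⟨Φ⁺| ⊗ |φ_{k,w}⟩⟨φ_{k,w}|) U_kᴴ) U_k |φ_{k,w}⟩|Φ⁺⟩`,
where `𝒜` and `U_k` act on one half `M₁` of `|Φ⁺⟩`, and the other half `M₂` is kept aside. -/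
def accSim (S : EncScheme K M T W) (𝒜 : SuperOp ((M × T) × R) ((M × T) × R')) : SuperOp R R' :=
  (Fintype.card K : ℂ)⁻¹ • ∑ k, ∑ w, (S.p k w : ℂ) •
    (detach (S.dummy k w) R').comp
      ((relabel (Equiv.prodAssoc M (M × T) R').symm).comp
        ((idTensor M 𝒜).comp
          ((relabel (Equiv.prodAssoc M (M × T) R)).comp (attach (S.dummy k w) R))))

/-- The fully mixed state `𝔼_k |k⟩⟨k|` of the key register. -/
def keyAcc (K L : Type) [Fintype K] [DecidableEq K] [DecidableEq L] :
    Matrix (K ⊕ L) (K ⊕ L) ℂ :=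
  (Fintype.card K : ℂ)⁻¹ • ∑ k : K, Matrix.single (Sum.inl k) (Sum.inl k) 1

/-- `𝔼_k |f k⟩⟨f k|`. -/
def keyRej (f : K → L) : Matrix (K ⊕ L) (K ⊕ L) ℂ :=
  (Fintype.card K : ℂ)⁻¹ • ∑ k : K, Matrix.single (Sum.inr (f k)) (Sum.inr (f k)) 1

/-- The ideal channel `id_M ⊗ 𝒮acc ⊗ 𝔼_k |k⟩⟨k| + |⊥⟩⟨⊥| tr_M ⊗ 𝒮rej ⊗ 𝔼_k |f k⟩⟨f k|`. -/
def ideal (f : K → L) (M : Type) [Fintype M] [DecidableEq M] (Sacc Srej : SuperOp R R') :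
    SuperOp (M × R) ((Option M × R') × (K ⊕ L)) :=
  (append _ (keyAcc K L)).comp (tensor (accEmbed M) Sacc) +
    (append _ (keyRej f)).comp (tensor (rejEmbed M) Srej)

/-- `Srej` completes the accepting simulator of the adversary `𝒜` to a simulator whose ideal
channel is `ε`-close to the real channel. -/
def IsRejSim (S : EncScheme K M T W) (f : K → L) (ε : ℝ≥0)
    (𝒜 : SuperOp ((M × T) × R) ((M × T) × R')) (Srej : SuperOp R R') : Prop :=
  Srej.IsCP ∧ IsTP (S.accSim 𝒜 + Srej) ∧
    diamondDist (S.real f 𝒜) (ideal f M (S.accSim 𝒜) Srej) ≤ ε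

/-- Ciphertext `ε`-authentication with key recycling, with recycling function `f`. The adversary is
any channel on the ciphertext and on a side-information register, the size of which it may
change. -/
def QCAR (S : EncScheme K M T W) (f : K → L) (ε : ℝ≥0) : Prop :=
  ∀ (R R' : Type) [Fintype R] [DecidableEq R] [Fintype R'] [DecidableEq R']
    (𝒜 : SuperOp ((M × T) × R) ((M × T) × R')), 𝒜.IsChannel →
    ∃ Srej : SuperOp R R', S.IsRejSim f ε 𝒜 Srej

end EncScheme

/-! ### Paulis, codes, and the canonical construction -/

/-- Bit strings of length `n`; the register of `n` qubits. -/
abbrev Bits (n : ℕ) : Type := Fin n → ZMod 2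

/-- The `n`-qubit Pauli operator `X^x Z^z`, that is, `|b⟩ ↦ (-1)^(z·b) |b + x⟩`. -/
def pauli {n : ℕ} (x z : Bits n) : Matrix (Bits n) (Bits n) ℂ :=
  Matrix.of fun a b => if a = b + x then (-1) ^ (z ⬝ᵥ b).val else 0

/-- Ciphertexts: `m` message qubits and `t` tag qubits. -/
abbrev Cipher (m t : ℕ) : Type := Bits m × Bits t

/-- Labels of the Paulis on `m + t` qubits: the positions of bit flips and phase flips, on the
message and on the tag. -/
abbrev PauliKey (m t : ℕ) : Type := (Bits m × Bits m) × (Bits t × Bits t)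

instance instDecidableEqPauliKey (m t : ℕ) : DecidableEq (PauliKey m t) := inferInstance

instance instFintypePauliKey (m t : ℕ) : Fintype (PauliKey m t) := inferInstance

/-- The Pauli with label `l` on `m + t` qubits. -/
def cipherPauli {m t : ℕ} (l : PauliKey m t) : Matrix (Cipher m t) (Cipher m t) ℂ :=
  pauli l.1.1 l.1.2 ⊗ₖ pauli l.2.1 l.2.2

theorem pauli_mem_unitary {n : ℕ} (x z : Bits n) :
    pauli x z ∈ unitary (Matrix (Bits n) (Bits n) ℂ) := by
  have h : star (pauli x z) * pauli x z = 1 := by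
    ext a b
    rw [Matrix.mul_apply]
    simp only [Matrix.star_apply, pauli, Matrix.of_apply]
    rw [Finset.sum_eq_single (b + x)]
    · by_cases hab : a = b
      · subst hab
        simp [← mul_pow]
      · have : b + x ≠ a + x := fun h => hab (add_right_cancel h).symm
        simp [this, hab]
    · intro c _ hc
      simp [hc]
    · simp
  exact Unitary.mem_iff.2 ⟨h, mul_eq_one_comm.1 h⟩

theorem cipherPauli_mem_unitary {m t : ℕ} (l : PauliKey m t) :
    cipherPauli l ∈ Matrix.unitaryGroup (Cipher m t) ℂ :=
  Matrix.kronecker_mem_unitary (pauli_mem_unitary _ _) (pauli_mem_unitary _ _)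

section Codes

variable {m t : ℕ} {K₁ : Type} [Fintype K₁]

/-- Applying a Pauli to a codeword is, up to a phase, the same as applying some Pauli to the message
and the tag before encoding. -/
def IsPauliCode (V : K₁ → Matrix.unitaryGroup (Cipher m t) ℂ) : Prop :=
  ∀ (k : K₁) (l : PauliKey m t), ∃ (l' : PauliKey m t) (θ : ℝ),
    cipherPauli l * (V k).1 = Complex.exp (θ * Complex.I) • ((V k).1 * cipherPauli l')

/-- Membership in `ℙ_m ⊗ {I, Z}^{⊗ t}`, up to a phase. -/
def IsUndetected (P : Matrix (Cipher m t) (Cipher m t) ℂ) : Prop :=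
  ∃ (x z : Bits m) (z' : Bits t) (θ : ℝ),
    P = Complex.exp (θ * Complex.I) • (pauli x z ⊗ₖ pauli 0 z')

/-- Strong purity testing with error `δ`: for every Pauli other than the identity, the probability
over a uniform key that it goes undetected is at most `δ`. -/
def IsStrongPurityTesting (V : K₁ → Matrix.unitaryGroup (Cipher m t) ℂ) (δ : ℝ) : Prop :=
  open Classical in
  ∀ l : PauliKey m t, l ≠ 0 →
    ((Finset.univ.filter fun k => IsUndetected ((V k).1ᴴ * cipherPauli l * (V k).1)).card : ℝ) /
      Fintype.card K₁ ≤ δ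

/-- The canonical encryption scheme of a family of codes: for the key `(k₁, k₂)` the unitary is
`P_{k₂} V_{k₁}`, and the tag is in the state `|0^t⟩⟨0^t|`. -/
def canonicalScheme (V : K₁ → Matrix.unitaryGroup (Cipher m t) ℂ) :
    EncScheme (K₁ × PauliKey m t) (Bits m) (Bits t) Unit where
  U k := ⟨cipherPauli k.2, cipherPauli_mem_unitary k.2⟩ * V k.1
  p _ _ := 1
  φ _ _ := Pi.single 0 1
  p_nonneg _ _ := zero_le_one
  p_sum _ := by simp
  φ_orthonormal _ w w' := by simp

end Codes

/-! ### Two messages under the same code key -/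

section Parallel

variable {m t : ℕ} {K₀ : Type} [Fintype K₀] [DecidableEq K₀]
  {R R₁ R₂ : Type} [Fintype R] [DecidableEq R] [Fintype R₁] [DecidableEq R₁]
  [Fintype R₂] [DecidableEq R₂]

/-- The exchange of the first two of three registers. -/
def exchange (A B C : Type) : A × (B × C) ≃ B × (A × C) where
  toFun x := (x.2.1, (x.1, x.2.2))
  invFun x := (x.2.1, (x.1, x.2.2))
  left_inv _ := rfl
  right_inv _ := rfl

/-- The map `Decrypt_{k₀,k₂} ∘ 𝒜₂ ∘ Decrypt_{k₀,k₁} ∘ 𝒜₁ ∘ (Encrypt_{k₀,k₁} ⊗ Encrypt_{k₀,k₂})`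
from `M₁ M₂ R` to the second (decrypted) message register and the side information that `𝒜₂`
outputs. -/
def parallelRealKeyed (V : K₀ → Matrix.unitaryGroup (Cipher m t) ℂ)
    (𝒜₁ : SuperOp (Cipher m t × (Cipher m t × R)) (Cipher m t × (Cipher m t × R₁)))
    (𝒜₂ : SuperOp (Option (Bits m) × (Cipher m t × R₁)) (Cipher m t × R₂))
    (k₀ : K₀) (k₁ k₂ : PauliKey m t) :
    SuperOp (Bits m × (Bits m × R)) (Option (Bits m) × R₂) :=
  (tensorId ((canonicalScheme V).decrypt (k₀, k₂)) R₂).comp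
    (𝒜₂.comp
      ((tensorId ((canonicalScheme V).decrypt (k₀, k₁)) (Cipher m t × R₁)).comp
        (𝒜₁.comp
          (tensor ((canonicalScheme V).encrypt (k₀, k₁))
            (tensorId ((canonicalScheme V).encrypt (k₀, k₂)) R)))))

/-- The real channel with key recycling: keys are uniform, `(k₀, k₂)` is revealed if the second
decryption accepts, and `k₀` if it rejects. -/
def parallelReal (V : K₀ → Matrix.unitaryGroup (Cipher m t) ℂ)
    (𝒜₁ : SuperOp (Cipher m t × (Cipher m t × R)) (Cipher m t × (Cipher m t × R₁)))
    (𝒜₂ : SuperOp (Option (Bits m) × (Cipher m t × R₁)) (Cipher m t × R₂)) :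
    SuperOp (Bits m × (Bits m × R))
      ((Option (Bits m) × R₂) × ((K₀ × PauliKey m t) ⊕ K₀)) :=
  (Fintype.card (K₀ × PauliKey m t × PauliKey m t) : ℂ)⁻¹ •
    ∑ k₀ : K₀, ∑ k₁ : PauliKey m t, ∑ k₂ : PauliKey m t,
      ((append _ (Matrix.single (Sum.inl (k₀, k₂)) (Sum.inl (k₀, k₂)) 1)).comp
          ((tensorId (projAcc (Bits m)) R₂).comp (parallelRealKeyed V 𝒜₁ 𝒜₂ k₀ k₁ k₂)) +
        (append _ (Matrix.single (Sum.inr k₀) (Sum.inr k₀) 1)).comp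
          ((tensorId (projRej (Bits m)) R₂).comp (parallelRealKeyed V 𝒜₁ 𝒜₂ k₀ k₁ k₂)))

/-- The ideal channel
`id_{M₂} ⊗ 𝒮acc ⊗ 𝔼 |k₀,k₂⟩⟨k₀,k₂| + |⊥⟩⟨⊥| tr_{M₂} ⊗ 𝒮rej ⊗ 𝔼 |k₀⟩⟨k₀|`
on `M₁ M₂ R`, where the simulators act on `M₁ R`. -/
def parallelIdeal (K₀ : Type) [Fintype K₀] [DecidableEq K₀] (m t : ℕ)
    (Sacc Srej : SuperOp (Bits m × R) R₂) :
    SuperOp (Bits m × (Bits m × R))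
      ((Option (Bits m) × R₂) × ((K₀ × PauliKey m t) ⊕ K₀)) :=
  (EncScheme.ideal (Prod.fst : K₀ × PauliKey m t → K₀) (Bits m) Sacc Srej).comp
    (relabel (exchange (Bits m) (Bits m) R))

/-- The effective adversary against the second ciphertext,
`𝒜₂ ∘ (id_{M₁} ⊗ 𝒮acc¹ + |⊥⟩⟨⊥| tr_{M₁} ⊗ 𝒮rej¹)`, acting on `C₂` and on the side information
`M₁ R`; here the transmission of the first message has been replaced by its simulation. -/
def secondAdversary
    (𝒜₂ : SuperOp (Option (Bits m) × (Cipher m t × R₁)) (Cipher m t × R₂))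
    (Sacc₁ Srej₁ : SuperOp (Cipher m t × R) (Cipher m t × R₁)) :
    SuperOp (Cipher m t × (Bits m × R)) (Cipher m t × R₂) :=
  𝒜₂.comp
    ((tensor (accEmbed (Bits m)) Sacc₁ + tensor (rejEmbed (Bits m)) Srej₁).comp
      (relabel (exchange (Cipher m t) (Bits m) R)))

end Parallel

end QAuth

end

open QAuth

/-!
The theorem reduces two messages to two uses of the security of one message. The difficulty is that
the second message is encrypted before the first adversary acts, under the code key `k₀` that both
messages share, whereas the security of the first message only speaks of tests that learn `k₀`
afterwards.

Teleportation resolves this. The key of the second message is `(k₀, k₂)` with a uniform Pauli label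
`k₂`, and its unitary is `P_{k₂} V_{k₀}`. So one half of a maximally entangled state `|Φ⁺⟩` of two
copies of the cipher register can be handed to the first adversary as the second ciphertext, and
later, once `k₀` is known, a joint measurement of the other half and of `V_{k₀} (M₂ ⊗ |0^t⟩)` turns
this ciphertext into the encryption of `M₂` under `(k₀, k₂)`, where the uniformly distributed
outcome `k₂` is the Pauli key (`conj_teleOut_conj_teleIn`, `sum_teleOut`). These effects form a
measurement because the Paulis are an orthogonal basis of the operators
(`sum_star_cipherPauli_mul_cipherPauli`).

Hence one positive trace-preserving map (`teleport`), which reads nothing but `k₀` from the revealed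
key, takes the output of the real channel of the first message to the output of the two-message
channel. On the ideal channel of the first message the code key is uniform and independent of
everything else, on accept as well as on reject, so that the same map produces the real channel of
the second message against `secondAdversary`. The trace norm of Hermitian operators does not
increase under positive trace-preserving maps (`traceNorm_apply_le`), so this step costs at most `ε`
(`diamondDist_parallelReal_le`). The second adversary is a channel, and the security of the second
message costs another `ε`; the triangle inequality gives `2 ε`.
-/

noncomputable section

namespace QAuth

open SuperOp
open scoped ComplexOrder

/-! ### The trace norm of Hermitian operators -/

section TraceNorm

variable {A B : Type} [Fintype A] [DecidableEq A] [Fintype B] [DecidableEq B]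

theorem hermitian_eq_conj_diagonal {H : Matrix A A ℂ} (hH : H.IsHermitian) :
    H = (hH.eigenvectorUnitary : Matrix A A ℂ) *
      Matrix.diagonal (fun i => (hH.eigenvalues i : ℂ)) *
      (hH.eigenvectorUnitary : Matrix A A ℂ)ᴴ := by
  conv_lhs => rw [hH.spectral_theorem, Unitary.conjStarAlgAut_apply]
  rfl

theorem traceNorm_eq_sum_abs_eigenvalues {H : Matrix A A ℂ} (hH : H.IsHermitian) :
    traceNorm H = ∑ i, |hH.eigenvalues i| := by
  have hS := Matrix.isHermitian_conjTranspose_mul_self H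
  set U : Matrix A A ℂ := (hH.eigenvectorUnitary : Matrix A A ℂ) with hU
  have hUU : Uᴴ * U = 1 := Unitary.coe_star_mul_self hH.eigenvectorUnitary
  -- `H` and `Hᴴ H` are diagonalized simultaneously, so the singular values are the `|λ i|`
  have hsq : Hᴴ * H = U * (Matrix.diagonal (fun i => ((hH.eigenvalues i ^ 2 : ℝ) : ℂ)) * Uᴴ) := by
    rw [hH.eq]
    conv_lhs => rw [hermitian_eq_conj_diagonal hH]
    rw [← hU]
    generalize hd : (fun i => (hH.eigenvalues i : ℂ)) = d
    calc U * Matrix.diagonal d * Uᴴ * (U * Matrix.diagonal d * Uᴴ)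
        = U * (Matrix.diagonal d * (Uᴴ * U) * Matrix.diagonal d * Uᴴ) := by
          simp only [Matrix.mul_assoc]
      _ = _ := by
          rw [hUU, Matrix.mul_one, Matrix.diagonal_mul_diagonal, ← hd]
          simp only [pow_two, Complex.ofReal_mul]
  have hroots : (Hᴴ * H).charpoly.roots =
      Multiset.map (fun i => ((hH.eigenvalues i ^ 2 : ℝ) : ℂ)) Finset.univ.val := by
    rw [hsq, Matrix.charpoly_mul_comm, Matrix.mul_assoc, hUU, Matrix.mul_one,
      Matrix.charpoly_diagonal, Polynomial.roots_prod]
    · simp only [Polynomial.roots_X_sub_C, Multiset.bind_singleton]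
    · exact Finset.prod_ne_zero_iff.2 fun i _ => Polynomial.X_sub_C_ne_zero _
  have hmap : Multiset.map hS.eigenvalues Finset.univ.val =
      Multiset.map (fun i => hH.eigenvalues i ^ 2) Finset.univ.val := by
    apply Multiset.map_injective Complex.ofReal_injective
    rw [Multiset.map_map, Multiset.map_map]
    exact hS.roots_charpoly_eq_eigenvalues.symm.trans hroots
  have := congrArg (fun s => (Multiset.map Real.sqrt s).sum) hmap
  simp only [Multiset.map_map, Function.comp_def, Real.sqrt_sq_eq_abs] at this
  exact this

/-- The Jordan decomposition: a Hermitian operator is a difference of positive operators whose traces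
add up to its trace norm. -/
theorem exists_posSemidef_sub_eq {H : Matrix A A ℂ} (hH : H.IsHermitian) :
    ∃ P Q : Matrix A A ℂ, P.PosSemidef ∧ Q.PosSemidef ∧ H = P - Q ∧
      P.trace.re + Q.trace.re = traceNorm H := by
  set U : Matrix A A ℂ := (hH.eigenvectorUnitary : Matrix A A ℂ) with hU
  have hUU : Uᴴ * U = 1 := Unitary.coe_star_mul_self hH.eigenvectorUnitary
  have hpos : ∀ d : A → ℝ, (∀ i, 0 ≤ d i) →
      (U * Matrix.diagonal (fun i => (d i : ℂ)) * Uᴴ).PosSemidef := fun d hd =>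
    (Matrix.PosSemidef.diagonal fun i => by simpa using hd i).mul_mul_conjTranspose_same U
  have htr : ∀ d : A → ℝ,
      (U * Matrix.diagonal (fun i => (d i : ℂ)) * Uᴴ).trace.re = ∑ i, d i := by
    intro d
    rw [Matrix.trace_mul_comm, ← Matrix.mul_assoc, hUU, Matrix.one_mul, Matrix.trace_diagonal]
    simp
  refine ⟨_, _, hpos (fun i => max (hH.eigenvalues i) 0) fun i => le_max_right _ _,
    hpos (fun i => max (-hH.eigenvalues i) 0) fun i => le_max_right _ _, ?_, ?_⟩
  · conv_lhs => rw [hermitian_eq_conj_diagonal hH]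
    rw [← Matrix.sub_mul, ← Matrix.mul_sub, Matrix.diagonal_sub]
    congr 3
    ext i
    rw [← Complex.ofReal_sub]
    congr 2
    exact (posPart_sub_negPart (hH.eigenvalues i)).symm
  · rw [htr, htr, ← Finset.sum_add_distrib, traceNorm_eq_sum_abs_eigenvalues hH]
    exact Finset.sum_congr rfl fun i _ => posPart_add_negPart (hH.eigenvalues i)

/-- In an eigenbasis of `P - Q`, each eigenvalue is the difference of the diagonal entries of `P` and
`Q`, which are nonnegative. -/
theorem traceNorm_sub_le {P Q : Matrix A A ℂ} (hP : P.PosSemidef) (hQ : Q.PosSemidef) :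
    traceNorm (P - Q) ≤ P.trace.re + Q.trace.re := by
  have hH : (P - Q).IsHermitian := hP.1.sub hQ.1
  set U : Matrix A A ℂ := (hH.eigenvectorUnitary : Matrix A A ℂ) with hU
  have hUU : Uᴴ * U = 1 := Unitary.coe_star_mul_self hH.eigenvectorUnitary
  have hUU' : U * Uᴴ = 1 := mul_eq_one_comm.1 hUU
  have htr : ∀ X : Matrix A A ℂ, (Uᴴ * X * U).trace = X.trace := fun X => by
    rw [Matrix.trace_mul_comm, ← Matrix.mul_assoc, hUU', Matrix.one_mul]
  have hdiag : Uᴴ * (P - Q) * U = Matrix.diagonal fun i => (hH.eigenvalues i : ℂ) := by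
    conv_lhs => rw [hermitian_eq_conj_diagonal hH]
    rw [← hU]
    generalize (fun i => (hH.eigenvalues i : ℂ)) = d
    calc Uᴴ * (U * Matrix.diagonal d * Uᴴ) * U
        = (Uᴴ * U) * Matrix.diagonal d * (Uᴴ * U) := by simp only [Matrix.mul_assoc]
      _ = _ := by rw [hUU, Matrix.one_mul, Matrix.mul_one]
  rw [traceNorm_eq_sum_abs_eigenvalues hH, ← htr P, ← htr Q, Matrix.trace, Matrix.trace,
    Complex.re_sum, Complex.re_sum, ← Finset.sum_add_distrib]
  refine Finset.sum_le_sum fun i _ => ?_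
  have h1 : 0 ≤ ((Uᴴ * P * U) i i).re :=
    (Complex.le_def.1 ((hP.conjTranspose_mul_mul_same U).diag_nonneg (i := i))).1
  have h2 : 0 ≤ ((Uᴴ * Q * U) i i).re :=
    (Complex.le_def.1 ((hQ.conjTranspose_mul_mul_same U).diag_nonneg (i := i))).1
  have h3 : hH.eigenvalues i = ((Uᴴ * P * U) i i).re - ((Uᴴ * Q * U) i i).re := by
    have := congrArg Complex.re (congrFun (congrFun hdiag i) i)
    rw [Matrix.mul_sub, Matrix.sub_mul] at this
    simpa using this.symm
  rw [h3]
  exact abs_le.2 ⟨by simp only [Matrix.diag_apply]; linarith,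
    by simp only [Matrix.diag_apply]; linarith⟩

theorem traceNorm_add_le {X Y : Matrix A A ℂ} (hX : X.IsHermitian) (hY : Y.IsHermitian) :
    traceNorm (X + Y) ≤ traceNorm X + traceNorm Y := by
  obtain ⟨P, Q, hP, hQ, rfl, hPQ⟩ := exists_posSemidef_sub_eq hX
  obtain ⟨P', Q', hP', hQ', rfl, hPQ'⟩ := exists_posSemidef_sub_eq hY
  have h := traceNorm_sub_le (hP.add hP') (hQ.add hQ')
  rw [Matrix.trace_add, Matrix.trace_add, Complex.add_re, Complex.add_re] at h
  rw [← hPQ, ← hPQ', show P - Q + (P' - Q') = P + P' - (Q + Q') by abel]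
  linarith

/-- Data processing for the trace norm. -/
theorem traceNorm_apply_le {Λ : SuperOp A B}
    (hpos : ∀ X : Matrix A A ℂ, X.PosSemidef → (Λ X).PosSemidef) (htr : Λ.IsTP)
    {X : Matrix A A ℂ} (hX : X.IsHermitian) : traceNorm (Λ X) ≤ traceNorm X := by
  obtain ⟨P, Q, hP, hQ, rfl, hPQ⟩ := exists_posSemidef_sub_eq hX
  have h := traceNorm_sub_le (hpos P hP) (hpos Q hQ)
  rwa [htr, htr, hPQ, ← map_sub] at h

end TraceNorm

/-! ### The diamond distance -/

theorem idTensor_add {A B : Type} (E : Type) (Φ Ψ : SuperOp A B) :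
    idTensor E (Φ + Ψ) = idTensor E Φ + idTensor E Ψ := rfl

theorem SuperOp.IsCP.isHermitian_idTensor_sub {A B : Type} {Φ Ψ : SuperOp A B} (hΦ : Φ.IsCP)
    (hΨ : Ψ.IsCP) {E : Type} [Fintype E] {ρ : Matrix (E × A) (E × A) ℂ} (hρ : ρ.PosSemidef) :
    (idTensor E (Φ - Ψ) ρ).IsHermitian :=
  (hΦ E ρ hρ).1.sub (hΨ E ρ hρ).1

section Diamond

variable {A B C D : Type} [Fintype A] [Fintype B] [DecidableEq B] [Fintype C] [Fintype D]
  [DecidableEq D]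

theorem traceNorm_le_diamondNorm (Φ : SuperOp A B) {E : Type} [Fintype E] [DecidableEq E]
    {ρ : Matrix (E × A) (E × A) ℂ} (hρ : IsDensity ρ) :
    ENNReal.ofReal (traceNorm (idTensor E Φ ρ)) ≤ diamondNorm Φ :=
  le_iSup_of_le E <| le_iSup_of_le inferInstance <| le_iSup_of_le inferInstance <|
    le_iSup_of_le ρ <| le_iSup_of_le hρ le_rfl

theorem diamondDist_triangle {Φ Ψ Ω : SuperOp A B} (hΦ : Φ.IsCP) (hΨ : Ψ.IsCP) (hΩ : Ω.IsCP) :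
    diamondDist Φ Ω ≤ diamondDist Φ Ψ + diamondDist Ψ Ω := by
  rw [diamondDist, diamondDist, diamondDist, ← mul_add]
  refine mul_le_mul' le_rfl ?_
  refine iSup_le fun E => iSup_le fun _ => iSup_le fun _ => iSup_le fun ρ => iSup_le fun hρ => ?_
  have h := traceNorm_add_le (hΦ.isHermitian_idTensor_sub hΨ hρ.1)
    (hΨ.isHermitian_idTensor_sub hΩ hρ.1)
  rw [← LinearMap.add_apply, ← idTensor_add, sub_add_sub_cancel] at h
  exact (ENNReal.ofReal_le_ofReal h).trans <| ENNReal.ofReal_add_le.trans <|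
    add_le_add (traceNorm_le_diamondNorm _ hρ) (traceNorm_le_diamondNorm _ hρ)

/-- Data processing for the diamond distance: if each output pair of `Φ, Ψ` on a joint state with an
environment is the image, under one positive trace-preserving map, of an output pair of
`Φ', Ψ'`, then `Φ, Ψ` are at most as far apart as `Φ', Ψ'`. -/
theorem diamondDist_le_of_simulation {Φ Ψ : SuperOp A B} {Φ' Ψ' : SuperOp C D}
    (hΦ' : Φ'.IsCP) (hΨ' : Ψ'.IsCP)
    (h : ∀ (E : Type) [Fintype E] [DecidableEq E] (ρ : Matrix (E × A) (E × A) ℂ), IsDensity ρ →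
      ∃ (E' : Type) (_ : Fintype E') (_ : DecidableEq E') (σ : Matrix (E' × C) (E' × C) ℂ)
        (Λ : SuperOp (E' × D) (E × B)), IsDensity σ ∧
        (∀ X : Matrix (E' × D) (E' × D) ℂ, X.PosSemidef → (Λ X).PosSemidef) ∧ Λ.IsTP ∧
        idTensor E Φ ρ = Λ (idTensor E' Φ' σ) ∧ idTensor E Ψ ρ = Λ (idTensor E' Ψ' σ)) :
    diamondDist Φ Ψ ≤ diamondDist Φ' Ψ' := by
  rw [diamondDist, diamondDist]
  refine mul_le_mul' le_rfl ?_
  refine iSup_le fun E => iSup_le fun _ => iSup_le fun _ => iSup_le fun ρ => iSup_le fun hρ => ?_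
  obtain ⟨E', _, _, σ, Λ, hσ, hpos, htr, h1, h2⟩ := h E ρ hρ
  have hle := traceNorm_apply_le hpos htr (hΦ'.isHermitian_idTensor_sub hΨ' hσ.1)
  have heq : idTensor E (Φ - Ψ) ρ = Λ (idTensor E' (Φ' - Ψ') σ) :=
    (congrArg₂ (· - ·) h1 h2).trans (Λ.map_sub _ _).symm
  rw [← heq] at hle
  exact (ENNReal.ofReal_le_ofReal hle).trans (traceNorm_le_diamondNorm _ hσ)

end Diamond

/-! ### Calculus of superoperators -/

section Calculus

variable {A B C D E F : Type}

/-- Linear maps on a composite register are determined by their values on product operators. -/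
theorem linearMap_ext_kronecker [Finite A] [Finite B] {N : Type*} [AddCommMonoid N] [Module ℂ N]
    {f g : Matrix (A × B) (A × B) ℂ →ₗ[ℂ] N}
    (h : ∀ (X : Matrix A A ℂ) (Y : Matrix B B ℂ), f (X ⊗ₖ Y) = g (X ⊗ₖ Y)) : f = g := by
  classical
  refine Matrix.ext_linearMap (R := ℂ) fun i j => LinearMap.ext fun c => ?_
  have := h (Matrix.single i.1 j.1 c) (Matrix.single i.2 j.2 1)
  rw [Matrix.single_kronecker_single, mul_one] at this
  exact this

theorem idTensor_kronecker (Φ : SuperOp A B) (X : Matrix E E ℂ) (Y : Matrix A A ℂ) :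
    idTensor E Φ (X ⊗ₖ Y) = X ⊗ₖ Φ Y := by
  ext i j
  exact congrFun (congrFun (Φ.map_smul (X i.1 j.1) Y) i.2) j.2

theorem tensorId_kronecker (Φ : SuperOp A B) (X : Matrix A A ℂ) (Y : Matrix E E ℂ) :
    tensorId Φ E (X ⊗ₖ Y) = Φ X ⊗ₖ Y := by
  ext i j
  have h : (Matrix.of fun a a' => (X ⊗ₖ Y) (a, i.2) (a', j.2)) = Y i.2 j.2 • X := by
    ext a a'
    exact mul_comm _ _
  change Φ (Matrix.of fun a a' => (X ⊗ₖ Y) (a, i.2) (a', j.2)) i.1 j.1 = _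
  rw [h, Φ.map_smul]
  exact mul_comm _ _

theorem tensor_kronecker (Φ : SuperOp A B) (Ψ : SuperOp C D) (X : Matrix A A ℂ)
    (Y : Matrix C C ℂ) : tensor Φ Ψ (X ⊗ₖ Y) = Φ X ⊗ₖ Ψ Y := by
  rw [tensor, LinearMap.comp_apply, tensorId_kronecker, idTensor_kronecker]

theorem tensor_eq_tensorId_comp_idTensor [Finite A] [Finite C] (Φ : SuperOp A B)
    (Ψ : SuperOp C D) : tensor Φ Ψ = (tensorId Φ D).comp (idTensor A Ψ) :=
  linearMap_ext_kronecker fun X Y => by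
    rw [tensor_kronecker, LinearMap.comp_apply, idTensor_kronecker, tensorId_kronecker]

theorem tensorId_comp (Φ : SuperOp B C) (Ψ : SuperOp A B) :
    tensorId (Φ.comp Ψ) E = (tensorId Φ E).comp (tensorId Ψ E) := rfl

theorem tensorId_add (Φ Ψ : SuperOp A B) :
    tensorId (Φ + Ψ) E = tensorId Φ E + tensorId Ψ E := rfl

theorem idTensor_smul (c : ℂ) (Φ : SuperOp A B) :
    idTensor E (c • Φ) = c • idTensor E Φ := rfl

theorem idTensor_sum {ι : Type*} (s : Finset ι) (Φ : ι → SuperOp A B) :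
    idTensor E (∑ i ∈ s, Φ i) = ∑ i ∈ s, idTensor E (Φ i) := by
  classical
  induction s using Finset.induction_on with
  | empty => rfl
  | insert i s hi ih => rw [Finset.sum_insert hi, Finset.sum_insert hi, idTensor_add, ih]

theorem conj_comp [Fintype A] [Fintype B] (K : Matrix C B ℂ) (L : Matrix B A ℂ) :
    (conj K).comp (conj L) = conj (K * L) := by
  ext1 X
  change K * (L * X * Lᴴ) * Kᴴ = K * L * X * (K * L)ᴴ
  rw [Matrix.conjTranspose_mul]
  simp only [Matrix.mul_assoc]

theorem conj_smul [Fintype A] (c : ℂ) (K : Matrix B A ℂ) :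
    conj (c • K) = (c * star c) • conj K := by
  ext1 X
  change (c • K) * X * (c • K)ᴴ = (c * star c) • (K * X * Kᴴ)
  rw [Matrix.conjTranspose_smul, Matrix.smul_mul, Matrix.smul_mul, Matrix.mul_smul, smul_smul]

theorem conj_kronecker [Fintype A] [Fintype C] (K : Matrix B A ℂ) (L : Matrix D C ℂ)
    (X : Matrix A A ℂ) (Y : Matrix C C ℂ) : conj (K ⊗ₖ L) (X ⊗ₖ Y) = conj K X ⊗ₖ conj L Y := by
  change (K ⊗ₖ L) * (X ⊗ₖ Y) * (K ⊗ₖ L)ᴴ = (K * X * Kᴴ) ⊗ₖ (L * Y * Lᴴ)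
  rw [Matrix.conjTranspose_kronecker, Matrix.mul_kronecker_mul, Matrix.mul_kronecker_mul]

theorem conj_one_apply [Fintype A] [DecidableEq A] (X : Matrix A A ℂ) :
    conj (1 : Matrix A A ℂ) X = X := by
  change 1 * X * 1ᴴ = X
  rw [Matrix.conjTranspose_one, Matrix.one_mul, Matrix.mul_one]

theorem idTensor_conj [Fintype A] [Fintype E] [DecidableEq E]
    (K : Matrix B A ℂ) : idTensor E (conj K) = conj ((1 : Matrix E E ℂ) ⊗ₖ K) :=
  linearMap_ext_kronecker fun X Y => by
    rw [idTensor_kronecker, conj_kronecker, conj_one_apply]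

theorem tensorId_conj [Fintype A] [Fintype E] [DecidableEq E]
    (K : Matrix B A ℂ) : tensorId (conj K) E = conj (K ⊗ₖ (1 : Matrix E E ℂ)) :=
  linearMap_ext_kronecker fun X Y => by
    rw [tensorId_kronecker, conj_kronecker, conj_one_apply]

/-- Operations on the environment commute with a superoperator on the system. -/
theorem conj_kronecker_idTensor [Fintype A] [Fintype B] [Fintype E] [DecidableEq A]
    (N : Matrix F E ℂ) (K : Matrix C B ℂ) (Φ : SuperOp A B) (X : Matrix (E × A) (E × A) ℂ) :
    conj (N ⊗ₖ K) (idTensor E Φ X) =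
      idTensor F ((conj K).comp Φ) (conj (N ⊗ₖ (1 : Matrix A A ℂ)) X) := by
  have h : (conj (N ⊗ₖ K)).comp (idTensor E Φ) =
      (idTensor F ((conj K).comp Φ)).comp (conj (N ⊗ₖ (1 : Matrix A A ℂ))) :=
    linearMap_ext_kronecker fun X Y => by
      simp only [LinearMap.comp_apply, idTensor_kronecker, conj_kronecker, conj_one_apply]
  exact LinearMap.congr_fun h X

/-! ### Complete positivity and trace preservation -/

theorem SuperOp.IsCP.posSemidef_apply {Φ : SuperOp A B} (hΦ : Φ.IsCP) {X : Matrix A A ℂ}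
    (hX : X.PosSemidef) : (Φ X).PosSemidef :=
  (hΦ Unit (X.submatrix Prod.snd Prod.snd) (hX.submatrix _)).submatrix (fun b => ((), b))

theorem SuperOp.IsCP.comp {Φ : SuperOp B C} {Ψ : SuperOp A B} (hΦ : Φ.IsCP) (hΨ : Ψ.IsCP) :
    IsCP (Φ.comp Ψ) := fun E _ X hX => hΦ E _ (hΨ E X hX)

theorem SuperOp.IsCP.add {Φ Ψ : SuperOp A B} (hΦ : Φ.IsCP) (hΨ : Ψ.IsCP) : IsCP (Φ + Ψ) :=
  fun E _ X hX => (hΦ E X hX).add (hΨ E X hX)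

theorem SuperOp.IsCP.smul {Φ : SuperOp A B} (hΦ : Φ.IsCP) {c : ℂ} (hc : 0 ≤ c) :
    IsCP (c • Φ) := fun E _ X hX => (hΦ E X hX).smul hc

theorem SuperOp.IsCP.zero : IsCP (0 : SuperOp A B) := fun _ _ _ _ => Matrix.PosSemidef.zero

theorem SuperOp.IsCP.sum {ι : Type*} (s : Finset ι) {Φ : ι → SuperOp A B}
    (hΦ : ∀ i, (Φ i).IsCP) : IsCP (∑ i ∈ s, Φ i) := by
  classical
  induction s using Finset.induction_on with
  | empty => exact SuperOp.IsCP.zero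
  | insert i s hi ih => rw [Finset.sum_insert hi]; exact (hΦ i).add ih

theorem SuperOp.IsCP.idTensor [Fintype E] {Φ : SuperOp A B} (hΦ : Φ.IsCP) :
    IsCP (idTensor E Φ) := fun E' _ X hX =>
  (hΦ (E' × E) (X.submatrix (Equiv.prodAssoc E' E A) (Equiv.prodAssoc E' E A))
    (hX.submatrix _)).submatrix (Equiv.prodAssoc E' E B).symm

theorem SuperOp.IsCP.tensorId [Fintype E] {Φ : SuperOp A B} (hΦ : Φ.IsCP) :
    IsCP (tensorId Φ E) := fun E' _ X hX =>
  (hΦ (E' × E) (X.submatrix (fun x => (x.1.1, (x.2, x.1.2))) (fun x => (x.1.1, (x.2, x.1.2))))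
    (hX.submatrix _)).submatrix (fun y : E' × (B × E) => ((y.1, y.2.2), y.2.1))

theorem SuperOp.IsCP.tensor [Fintype B] [Fintype C] {Φ : SuperOp A B} {Ψ : SuperOp C D}
    (hΦ : Φ.IsCP) (hΨ : Ψ.IsCP) : IsCP (tensor Φ Ψ) := hΨ.idTensor.comp hΦ.tensorId

theorem isCP_conj [Fintype A] [Fintype B] (K : Matrix B A ℂ) : IsCP (conj K) := by
  classical
  intro E _ X hX
  rw [idTensor_conj]
  exact hX.mul_mul_conjTranspose_same _

theorem isCP_relabel (e : A ≃ B) : IsCP (relabel e) := fun E _ _ hX =>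
  hX.submatrix (fun y : E × B => (y.1, e.symm y.2))

theorem isCP_append [Finite A] [Finite B] {σ : Matrix B B ℂ} (hσ : σ.PosSemidef) :
    IsCP (append A σ) := fun E _ _ hX =>
  (hX.kronecker hσ).submatrix (fun y : E × (A × B) => ((y.1, y.2.1), y.2.2))

theorem isCP_attach [Finite A] [Finite B] (v : B → ℂ) : IsCP (attach v A) := fun E _ X hX => by
  have h : idTensor E (attach v A) X = (Matrix.vecMulVec v (star v) ⊗ₖ X).submatrix
      (fun y : E × (B × A) => (y.2.1, (y.1, y.2.2))) (fun y => (y.2.1, (y.1, y.2.2))) := rfl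
  rw [h]
  exact ((Matrix.posSemidef_vecMulVec_self_star v).kronecker hX).submatrix _

theorem isCP_detach [Fintype A] [Fintype B] (v : B → ℂ) : IsCP (detach v A) := by
  classical
  have h : detach v A = conj (Matrix.of fun (a : A) (x : B × A) =>
      if a = x.2 then star (v x.1) else 0) := by
    ext X a a'
    change ∑ b, ∑ b', star (v b) * X (b, a) (b', a') * v b' =
      ((Matrix.of fun (a : A) (x : B × A) => if a = x.2 then star (v x.1) else 0) * X *
        (Matrix.of fun (a : A) (x : B × A) => if a = x.2 then star (v x.1) else 0)ᴴ) a a'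
    simp only [Matrix.mul_apply, Matrix.conjTranspose_apply, Matrix.of_apply, apply_ite star,
      star_zero, star_star, mul_ite, ite_mul, zero_mul, mul_zero, Fintype.sum_prod_type,
      Finset.sum_ite_eq, Finset.mem_univ, if_true, Finset.sum_mul]
    exact Finset.sum_comm
  rw [h]
  exact isCP_conj _

theorem isCP_traceRight [Fintype B] : IsCP (traceRight A B) := fun E _ X hX => by
  have h : idTensor E (traceRight A B) X =
      ∑ b, X.submatrix (fun y : E × A => (y.1, (y.2, b))) (fun y => (y.1, (y.2, b))) := by
    ext i j
    simp [idTensor, traceRight, Matrix.sum_apply]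
  rw [h]
  exact Matrix.posSemidef_sum _ fun b _ => hX.submatrix _

theorem isCP_replace [Fintype A] [Finite B] {σ : Matrix B B ℂ} (hσ : σ.PosSemidef) :
    IsCP (replace (A := A) σ) := fun E _ X hX => by
  have h : (traceRight E A X).PosSemidef := isCP_traceRight.posSemidef_apply hX
  exact h.kronecker hσ

theorem SuperOp.IsTP.comp [Fintype A] [Fintype B] [Fintype C] {Φ : SuperOp B C}
    {Ψ : SuperOp A B} (hΦ : Φ.IsTP) (hΨ : Ψ.IsTP) : IsTP (Φ.comp Ψ) :=
  fun X => (hΦ _).trans (hΨ X)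

theorem trace_conj [Fintype A] [Fintype B] (K : Matrix B A ℂ) (X : Matrix A A ℂ) :
    (conj K X).trace = (Kᴴ * K * X).trace := by
  change (K * X * Kᴴ).trace = _
  rw [Matrix.trace_mul_comm, Matrix.mul_assoc]

theorem isTP_conj [Fintype A] [DecidableEq A] [Fintype B] {K : Matrix B A ℂ} (hK : Kᴴ * K = 1) :
    IsTP (conj K) := fun X => by rw [trace_conj, hK, Matrix.one_mul]

theorem isTP_relabel [Fintype A] [Fintype B] (e : A ≃ B) : IsTP (relabel e) := fun X =>
  e.symm.sum_comp fun a => X a a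

theorem isTP_append [Fintype A] [Fintype B] {σ : Matrix B B ℂ} (hσ : σ.trace = 1) :
    IsTP (append A σ) := fun X => by
  change (X ⊗ₖ σ).trace = _
  rw [Matrix.trace_kronecker, hσ, mul_one]

theorem isTP_replace [Fintype A] [Fintype B] {σ : Matrix B B ℂ} (hσ : σ.trace = 1) :
    IsTP (replace (A := A) σ) := fun X => by
  change (X.trace • σ).trace = _
  rw [Matrix.trace_smul, hσ, smul_eq_mul, mul_one]

theorem SuperOp.IsTP.idTensor [Fintype A] [Fintype B] [Fintype E] {Φ : SuperOp A B}
    (hΦ : Φ.IsTP) : IsTP (idTensor E Φ) := fun X => by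
  rw [Matrix.trace, Matrix.trace, Fintype.sum_prod_type, Fintype.sum_prod_type]
  exact Finset.sum_congr rfl fun e _ => hΦ (Matrix.of fun a a' => X (e, a) (e, a'))

theorem SuperOp.IsTP.tensorId [Fintype A] [Fintype B] [Fintype E] {Φ : SuperOp A B}
    (hΦ : Φ.IsTP) : IsTP (tensorId Φ E) := fun X => by
  rw [Matrix.trace, Matrix.trace, Fintype.sum_prod_type_right, Fintype.sum_prod_type_right]
  exact Finset.sum_congr rfl fun e _ => hΦ (Matrix.of fun a a' => X (a, e) (a', e))

/-- If both `Φᵢ` preserve the trace, then so does `∑ Φᵢ ⊗ Ψᵢ` as soon as `∑ Ψᵢ` does. -/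
theorem isTP_tensor_add_tensor [Fintype A] [Fintype B] [Fintype C] [Fintype D]
    {Φ₁ Φ₂ : SuperOp A B} {Ψ₁ Ψ₂ : SuperOp C D} (h₁ : Φ₁.IsTP) (h₂ : Φ₂.IsTP)
    (h : IsTP (Ψ₁ + Ψ₂)) : IsTP (tensor Φ₁ Ψ₁ + tensor Φ₂ Ψ₂) := fun X => by
  refine LinearMap.congr_fun (f := (Matrix.traceLinearMap (B × D) ℂ ℂ).comp
    (tensor Φ₁ Ψ₁ + tensor Φ₂ Ψ₂)) (g := Matrix.traceLinearMap (A × C) ℂ ℂ)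
    (linearMap_ext_kronecker fun X Y => ?_) X
  have hY : (Ψ₁ Y).trace + (Ψ₂ Y).trace = Y.trace := by
    rw [← Matrix.trace_add]
    exact h Y
  change (tensor Φ₁ Ψ₁ (X ⊗ₖ Y) + tensor Φ₂ Ψ₂ (X ⊗ₖ Y)).trace = (X ⊗ₖ Y).trace
  rw [tensor_kronecker, tensor_kronecker, Matrix.trace_add, Matrix.trace_kronecker,
    Matrix.trace_kronecker, Matrix.trace_kronecker, h₁, h₂, ← mul_add, hY]

end Calculus

/-! ### The maps of an encryption scheme -/

theorem posSemidef_single {B : Type} [Finite B] [DecidableEq B] (b : B) :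
    (Matrix.single b b (1 : ℂ)).PosSemidef := by
  have h : Matrix.single b b (1 : ℂ) =
      Matrix.vecMulVec (Pi.single b 1) (star (Pi.single b (1 : ℂ))) := by
    ext i j
    simp [Matrix.single_apply, Matrix.vecMulVec_apply, Pi.single_apply]
    grind
  rw [h]
  exact Matrix.posSemidef_vecMulVec_self_star _

theorem trace_single_self {B : Type} [Fintype B] [DecidableEq B] (b : B) :
    (Matrix.single b b (1 : ℂ)).trace = 1 := Matrix.trace_single_eq_same b 1

section Message

variable (M : Type) [Fintype M] [DecidableEq M]

theorem isTP_accEmbed : IsTP (accEmbed M) := by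
  refine isTP_conj ?_
  ext a b
  simp [Matrix.mul_apply, Matrix.conjTranspose_apply, Matrix.one_apply, eq_comm]

theorem isTP_rejEmbed : IsTP (rejEmbed M) := isTP_replace (trace_single_self _)

theorem isCP_accEmbed : IsCP (accEmbed M) := isCP_conj _

theorem isCP_rejEmbed : IsCP (rejEmbed M) := isCP_replace (posSemidef_single _)

theorem botState_mul_self : botState M * botState M = botState M := by
  simp [botState]

theorem conjTranspose_botState (M : Type) [DecidableEq M] : (botState M)ᴴ = botState M := by
  simp [botState]

theorem projRej_comp_accEmbed : (projRej M).comp (accEmbed M) = 0 := by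
  rw [projRej, accEmbed, conj_comp]
  have h : botState M * (Matrix.of fun (o : Option M) (a : M) => if o = some a then (1 : ℂ) else 0)
      = 0 := by
    ext o a
    simp [botState, Matrix.mul_apply, Matrix.single_apply]
  rw [h]
  ext1 X
  exact (congrArg (· * _) (Matrix.zero_mul X)).trans (Matrix.zero_mul _)

theorem projAcc_comp_accEmbed : (projAcc M).comp (accEmbed M) = accEmbed M := by
  rw [projAcc, accEmbed, conj_comp]
  congr 1
  ext o a
  simp [botState, Matrix.mul_apply, Matrix.single_apply, Matrix.one_apply]

theorem projAcc_comp_replace_botState (A : Type) [Fintype A] :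
    (projAcc M).comp (replace (A := A) (botState M)) = 0 := by
  ext1 X
  change (1 - botState M) * (X.trace • botState M) * (1 - botState M)ᴴ = 0
  rw [Matrix.mul_smul, Matrix.sub_mul, Matrix.one_mul, botState_mul_self, sub_self, smul_zero,
    Matrix.zero_mul]

theorem projRej_comp_replace_botState (A : Type) [Fintype A] :
    (projRej M).comp (replace (A := A) (botState M)) = replace (botState M) := by
  ext1 X
  change botState M * (X.trace • botState M) * (botState M)ᴴ = X.trace • botState M
  rw [Matrix.mul_smul, conjTranspose_botState, botState_mul_self, Matrix.smul_mul,
    botState_mul_self]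

end Message

namespace EncScheme

variable {K M T W L R R' : Type} [Fintype M] [DecidableEq M]
  [Fintype T] [DecidableEq T] [Fintype W] [DecidableEq W]

theorem projAcc_comp_decrypt (S : EncScheme K M T W) (k : K) :
    (projAcc M).comp (S.decrypt k) = S.decryptAcc k := by
  rw [decrypt, decryptAcc, decryptRej, LinearMap.comp_add, ← LinearMap.comp_assoc,
    ← LinearMap.comp_assoc _ (replace _), projAcc_comp_accEmbed, projAcc_comp_replace_botState,
    LinearMap.zero_comp, add_zero]

theorem projRej_comp_decrypt (S : EncScheme K M T W) (k : K) :
    (projRej M).comp (S.decrypt k) = S.decryptRej k := by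
  rw [decrypt, decryptAcc, decryptRej, LinearMap.comp_add, ← LinearMap.comp_assoc,
    ← LinearMap.comp_assoc _ (replace _), projRej_comp_accEmbed, projRej_comp_replace_botState,
    LinearMap.zero_comp, zero_add]

theorem isCP_encrypt (S : EncScheme K M T W) (k : K) : IsCP (S.encrypt k) := by
  refine (isCP_conj _).comp (isCP_append (Matrix.posSemidef_sum _ fun w _ => ?_))
  exact (Matrix.posSemidef_vecMulVec_self_star _).smul (by exact_mod_cast S.p_nonneg k w)

theorem isCP_decryptAcc (S : EncScheme K M T W) (k : K) : IsCP (S.decryptAcc k) :=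
  (isCP_accEmbed M).comp <| isCP_traceRight.comp <| (isCP_conj _).comp (isCP_conj _)

theorem isCP_decryptRej (S : EncScheme K M T W) (k : K) : IsCP (S.decryptRej k) :=
  (isCP_replace (posSemidef_single _)).comp <| (isCP_conj _).comp (isCP_conj _)

theorem isTP_decrypt (S : EncScheme K M T W) (k : K) (hH : (S.tagProj k)ᴴ = S.tagProj k)
    (hP : S.tagProj k * S.tagProj k = S.tagProj k) : IsTP (S.decrypt k) := by
  intro X
  obtain ⟨Y, hY⟩ : ∃ Y, Y = conj (S.mat k)ᴴ X := ⟨_, rfl⟩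
  have hYX : Y.trace = X.trace := by
    have h : S.mat k * (S.mat k)ᴴ = 1 := Unitary.coe_mul_star_self (S.U k)
    rw [hY, trace_conj, Matrix.conjTranspose_conjTranspose, h, Matrix.one_mul]
  have hacc : (S.decryptAcc k X).trace =
      (conj ((1 : Matrix M M ℂ) ⊗ₖ S.tagProj k) Y).trace := by
    rw [hY]
    refine (isTP_accEmbed M _).trans ?_
    rw [Matrix.trace, Matrix.trace, Fintype.sum_prod_type]
    rfl
  have hrej : (S.decryptRej k X).trace =
      (conj ((1 : Matrix M M ℂ) ⊗ₖ (1 - S.tagProj k)) Y).trace := by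
    rw [hY]
    exact isTP_replace (trace_single_self _) _
  have hsum : S.tagProj k + (1 - S.tagProj k) * (1 - S.tagProj k) = 1 := by
    rw [Matrix.mul_sub, Matrix.mul_one, Matrix.sub_mul, Matrix.one_mul, hP]
    abel
  rw [decrypt, LinearMap.add_apply, Matrix.trace_add, hacc, hrej, trace_conj, trace_conj,
    ← Matrix.trace_add, ← Matrix.add_mul, Matrix.conjTranspose_kronecker,
    Matrix.conjTranspose_kronecker, ← Matrix.mul_kronecker_mul, ← Matrix.mul_kronecker_mul,
    Matrix.conjTranspose_one, Matrix.one_mul, ← Matrix.kronecker_add, Matrix.conjTranspose_sub,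
    hH, Matrix.conjTranspose_one, hP, hsum, Matrix.one_kronecker_one, Matrix.one_mul, hYX]

theorem inv_card_nonneg (K : Type) [Fintype K] : (0 : ℂ) ≤ (Fintype.card K : ℂ)⁻¹ := by
  rw [← Complex.ofReal_natCast, ← Complex.ofReal_inv]
  exact_mod_cast inv_nonneg.2 (Nat.cast_nonneg (α := ℝ) _)

theorem isCP_accSim [Fintype K] [Fintype R] [Fintype R'] (S : EncScheme K M T W)
    {𝒜 : SuperOp ((M × T) × R) ((M × T) × R')}
    (h𝒜 : 𝒜.IsCP) : IsCP (S.accSim 𝒜) := by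
  refine (SuperOp.IsCP.sum _ fun k => SuperOp.IsCP.sum _ fun w => ?_).smul (inv_card_nonneg K)
  refine SuperOp.IsCP.smul ?_ (by exact_mod_cast S.p_nonneg k w)
  exact (isCP_detach _).comp <| (isCP_relabel _).comp <| h𝒜.idTensor.comp <|
    (isCP_relabel _).comp (isCP_attach _)

section Keyed

variable [Fintype K] [DecidableEq K] [DecidableEq L]

/-- The average over uniform keys `k` of `Φ k ⊗ |k⟩⟨k| + Ψ k ⊗ |f k⟩⟨f k|`. -/
def keyed {A B : Type} (f : K → L) (Φ Ψ : K → SuperOp A B) : SuperOp A (B × (K ⊕ L)) :=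
  (Fintype.card K : ℂ)⁻¹ • ∑ k,
    ((append B (Matrix.single (Sum.inl k) (Sum.inl k) 1)).comp (Φ k) +
      (append B (Matrix.single (Sum.inr (f k)) (Sum.inr (f k)) 1)).comp (Ψ k))

theorem isCP_keyed {A B : Type} [Finite B] [Finite L] {f : K → L} {Φ Ψ : K → SuperOp A B}
    (hΦ : ∀ k, (Φ k).IsCP) (hΨ : ∀ k, (Ψ k).IsCP) : IsCP (keyed f Φ Ψ) :=
  (SuperOp.IsCP.sum _ fun k => ((isCP_append (posSemidef_single _)).comp (hΦ k)).add
    ((isCP_append (posSemidef_single _)).comp (hΨ k))).smul (inv_card_nonneg K)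

theorem real_eq_keyed (S : EncScheme K M T W) (f : K → L)
    (𝒜 : SuperOp ((M × T) × R) ((M × T) × R')) :
    S.real f 𝒜 = keyed f
      (fun k => (tensorId (S.decryptAcc k) R').comp (𝒜.comp (tensorId (S.encrypt k) R)))
      (fun k => (tensorId (S.decryptRej k) R').comp (𝒜.comp (tensorId (S.encrypt k) R))) := rfl

theorem append_smul_sum {A B ι : Type} [Fintype ι] (c : ℂ) (σ : ι → Matrix B B ℂ) :
    append A (c • ∑ i, σ i) = c • ∑ i, append A (σ i) := by
  ext X i j
  simp [append, Matrix.sum_apply, Finset.mul_sum, mul_left_comm]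

theorem ideal_eq_keyed (f : K → L) (Sacc Srej : SuperOp R R') :
    ideal f M Sacc Srej = keyed f (fun _ => tensor (accEmbed M) Sacc)
      (fun _ => tensor (rejEmbed M) Srej) := by
  rw [ideal, keyed, keyAcc, keyRej, append_smul_sum, append_smul_sum, Finset.sum_add_distrib,
    smul_add, LinearMap.smul_comp, LinearMap.smul_comp]
  congr 2 <;> (ext1 X; simp [LinearMap.sum_apply])

theorem isCP_real [Finite L] [Fintype R] [Fintype R'] (S : EncScheme K M T W)
    (f : K → L) {𝒜 : SuperOp ((M × T) × R) ((M × T) × R')} (h𝒜 : 𝒜.IsCP) : IsCP (S.real f 𝒜) :=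
  isCP_keyed
    (fun k => (S.isCP_decryptAcc k).tensorId.comp (h𝒜.comp (S.isCP_encrypt k).tensorId))
    (fun k => (S.isCP_decryptRej k).tensorId.comp (h𝒜.comp (S.isCP_encrypt k).tensorId))

theorem isCP_ideal [Finite L] [Fintype R] [Fintype R'] (f : K → L)
    {Sacc Srej : SuperOp R R'} (hacc : Sacc.IsCP) (hrej : Srej.IsCP) :
    IsCP (ideal f M Sacc Srej) := by
  rw [ideal_eq_keyed]
  exact isCP_keyed (fun _ => (isCP_accEmbed M).tensor hacc) fun _ => (isCP_rejEmbed M).tensor hrej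

end Keyed

end EncScheme

/-! ### The canonical scheme -/

section Canonical

variable {m t : ℕ} {K₀ : Type}

/-- Summing over phase flips separates basis states. -/
theorem sum_neg_one_pow_dotProduct {n : ℕ} (b b' : Bits n) :
    ∑ z : Bits n, ((-1) ^ (z ⬝ᵥ b).val * (-1) ^ (z ⬝ᵥ b').val : ℂ) =
      if b = b' then (Fintype.card (Bits n) : ℂ) else 0 := by
  have hadd : ∀ x y : ZMod 2, (-1 : ℂ) ^ (x + y).val = (-1) ^ x.val * (-1) ^ y.val := by
    intro x y
    rw [← pow_add, ZMod.val_add, ← neg_one_pow_eq_pow_mod_two]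
  split_ifs with h
  · subst h
    simp [← mul_pow]
  · obtain ⟨i, hi⟩ := Function.ne_iff.1 h
    have hbb : b i + b' i = 1 := by
      generalize b i = x at hi
      generalize b' i = y at hi
      revert x y
      decide
    -- flipping the `i`-th bit of `z` changes the sign of the summand
    have hflip := Fintype.sum_equiv (Equiv.addRight (Pi.single i 1 : Bits n)) _
      (fun z : Bits n => ((-1) ^ (z ⬝ᵥ b).val * (-1) ^ (z ⬝ᵥ b').val : ℂ)) fun _ => rfl
    have hneg : ∀ z : Bits n, ((-1) ^ ((z + Pi.single i 1) ⬝ᵥ b).val *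
        (-1) ^ ((z + Pi.single i 1) ⬝ᵥ b').val : ℂ) =
          -((-1) ^ (z ⬝ᵥ b).val * (-1) ^ (z ⬝ᵥ b').val) := by
      intro z
      have h1 : (-1 : ℂ) ^ (b i).val * (-1) ^ (b' i).val = -1 := by
        rw [← hadd, hbb]
        simp [ZMod.val_one]
      rw [add_dotProduct, add_dotProduct, hadd, hadd, single_one_dotProduct,
        single_one_dotProduct, mul_mul_mul_comm, h1, mul_neg_one]
    simp only [Equiv.coe_addRight, hneg, Finset.sum_neg_distrib] at hflip
    exact self_eq_neg.1 hflip.symm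

theorem sum_star_pauli_mul_pauli {n : ℕ} (a b a' b' : Bits n) :
    ∑ x : Bits n, ∑ z : Bits n, star (pauli x z a b) * pauli x z a' b' =
      if a = a' ∧ b = b' then (Fintype.card (Bits n) : ℂ) else 0 := by
  have h : ∀ x : Bits n, ∑ z : Bits n, star (pauli x z a b) * pauli x z a' b' =
      if x = a - b then if a' - b' = x then
        if b = b' then (Fintype.card (Bits n) : ℂ) else 0 else 0 else 0 := by
    intro x
    have h1 : (a = b + x) ↔ x = a - b := by rw [eq_sub_iff_add_eq', eq_comm]
    have h2 : (a' = b' + x) ↔ a' - b' = x := by rw [sub_eq_iff_eq_add']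
    simp only [pauli, Matrix.of_apply, h1, h2]
    have hsum := sum_neg_one_pow_dotProduct b b'
    by_cases h3 : x = a - b <;> by_cases h4 : a' - b' = x
    · rw [if_pos h3, if_pos h4, ← hsum]
      simp [h3, h4]
    · simp [if_pos h3, if_neg h4]
    · simp [h3, h4]
    · simp [h3, h4]
  simp only [h, Finset.sum_ite_eq', Finset.mem_univ, if_true]
  grind

/-- The Paulis are an orthogonal basis of the operators on the cipher register. -/
theorem sum_star_cipherPauli_mul_cipherPauli (c x c' x' : Cipher m t) :
    ∑ l : PauliKey m t, star (cipherPauli l c x) * cipherPauli l c' x' =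
      if c = c' ∧ x = x' then (Fintype.card (Cipher m t) : ℂ) else 0 := by
  have h := congrArg₂ (· * ·) (sum_star_pauli_mul_pauli c.1 x.1 c'.1 x'.1)
    (sum_star_pauli_mul_pauli c.2 x.2 c'.2 x'.2)
  rw [← Fintype.sum_prod_type', ← Fintype.sum_prod_type', Finset.sum_mul_sum,
    ← Fintype.sum_prod_type'] at h
  refine Eq.trans (Finset.sum_congr rfl fun l _ => ?_) (h.trans ?_)
  · change star (pauli l.1.1 l.1.2 c.1 x.1 * pauli l.2.1 l.2.2 c.2 x.2) *
      (pauli l.1.1 l.1.2 c'.1 x'.1 * pauli l.2.1 l.2.2 c'.2 x'.2) = _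
    rw [star_mul']
    exact mul_mul_mul_comm _ _ _ _
  · rw [Fintype.card_prod, Nat.cast_mul]
    simp only [Prod.ext_iff]
    grind

/-- The isometry `|a⟩ ↦ U_k |a⟩|0^t⟩`. -/
def encMat (V : K₀ → Matrix.unitaryGroup (Cipher m t) ℂ) (k : K₀ × PauliKey m t) :
    Matrix (Cipher m t) (Bits m) ℂ :=
  Matrix.of fun c a => (canonicalScheme V).mat k c (a, 0)

theorem encrypt_canonicalScheme (V : K₀ → Matrix.unitaryGroup (Cipher m t) ℂ)
    (k : K₀ × PauliKey m t) : (canonicalScheme V).encrypt k = conj (encMat V k) := by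
  have h : append (Bits m) ((canonicalScheme V).tagState k) =
      conj (Matrix.of fun (x : Cipher m t) (a : Bits m) => if x = (a, 0) then 1 else 0) := by
    ext X x y
    change X x.1 y.1 * (canonicalScheme V).tagState k x.2 y.2 =
      ((Matrix.of fun (x : Cipher m t) (a : Bits m) => if x = (a, 0) then (1 : ℂ) else 0) * X *
        (Matrix.of fun (x : Cipher m t) (a : Bits m) => if x = (a, 0) then (1 : ℂ) else 0)ᴴ) x y
    obtain ⟨x, u⟩ := x
    obtain ⟨y, v⟩ := y
    simp only [EncScheme.tagState, canonicalScheme, Matrix.mul_apply, Matrix.of_apply,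
      Matrix.conjTranspose_apply, Prod.mk.injEq]
    by_cases hu : u = 0 <;> by_cases hv : v = 0 <;> simp [hu, hv, Matrix.vecMulVec_apply]
  rw [EncScheme.encrypt, h, conj_comp]
  congr 1
  ext c a
  simp [Matrix.mul_apply, encMat]

/-- For a fixed code key, uniform Pauli keys decouple the ciphertext from the message. -/
theorem sum_star_encMat_mul_encMat (V : K₀ → Matrix.unitaryGroup (Cipher m t) ℂ) (k₀ : K₀)
    (c c' : Cipher m t) (a a' : Bits m) :
    ∑ l : PauliKey m t, star (encMat V (k₀, l) c a) * encMat V (k₀, l) c' a' =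
      if c = c' ∧ a = a' then (Fintype.card (Cipher m t) : ℂ) else 0 := by
  have hV : ((V k₀).1ᴴ * (V k₀).1) (a, 0) (a', 0) =
      (1 : Matrix (Cipher m t) (Cipher m t) ℂ) (a, 0) (a', 0) :=
    congrFun (congrFun (Unitary.coe_star_mul_self (V k₀)) _) _
  have hmat : ∀ (l : PauliKey m t) (c : Cipher m t) (a : Bits m),
      encMat V (k₀, l) c a = ∑ x, cipherPauli l c x * (V k₀).1 x (a, 0) := fun _ _ _ => rfl
  calc ∑ l : PauliKey m t, star (encMat V (k₀, l) c a) * encMat V (k₀, l) c' a'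
      = ∑ l : PauliKey m t, ∑ x, ∑ x', (star (cipherPauli l c x) * cipherPauli l c' x') *
          (star ((V k₀).1 x (a, 0)) * (V k₀).1 x' (a', 0)) := by
        refine Finset.sum_congr rfl fun l _ => ?_
        rw [hmat, hmat, star_sum, Finset.sum_mul_sum]
        refine Finset.sum_congr rfl fun x _ => Finset.sum_congr rfl fun x' _ => ?_
        rw [star_mul']
        exact mul_mul_mul_comm _ _ _ _
    _ = ∑ x, ∑ x', (∑ l : PauliKey m t, star (cipherPauli l c x) * cipherPauli l c' x') *
          (star ((V k₀).1 x (a, 0)) * (V k₀).1 x' (a', 0)) := by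
        rw [Finset.sum_comm]
        refine Finset.sum_congr rfl fun x _ => ?_
        rw [Finset.sum_comm]
        refine Finset.sum_congr rfl fun x' _ => ?_
        rw [Finset.sum_mul]
    _ = if c = c' then Fintype.card (Cipher m t) * ((V k₀).1ᴴ * (V k₀).1) (a, 0) (a', 0)
          else 0 := by
        simp only [sum_star_cipherPauli_mul_cipherPauli]
        split_ifs with h
        · simp [h, Matrix.mul_apply, Finset.mul_sum]
        · simp [h]
    _ = _ := by
        rw [hV]
        by_cases h : c = c' <;> by_cases h' : a = a' <;> simp [h, h', Matrix.one_apply]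

theorem isTP_decrypt_canonicalScheme (V : K₀ → Matrix.unitaryGroup (Cipher m t) ℂ)
    (k : K₀ × PauliKey m t) : IsTP ((canonicalScheme V).decrypt k) := by
  have hP : (canonicalScheme V).tagProj k = Matrix.single 0 0 1 := by
    ext i j
    simp [EncScheme.tagProj, canonicalScheme, Matrix.vecMulVec_apply, Matrix.single_apply,
      Pi.single_apply]
    grind
  refine (canonicalScheme V).isTP_decrypt k ?_ ?_ <;> rw [hP] <;> simp

end Canonical

/-! ### Teleportation through the Pauli key -/

section Teleport

variable {m t : ℕ} {K₀ : Type}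

/-- The isometry which keeps `M₂` aside and puts in the place of the second ciphertext one half of
a maximally entangled state `|Φ⁺⟩` of two copies of the cipher register; the other half and `M₂`
join the environment `E`. The register `M₁` and the side information `R` are untouched. -/
def teleIn (E : Type) [DecidableEq E] (m t : ℕ) (R : Type) [DecidableEq R] :
    Matrix ((E × (Cipher m t × Bits m)) × (Bits m × (Cipher m t × R)))
      (E × (Bits m × (Bits m × R))) ℂ :=
  Matrix.of fun x y =>
    if x.1.1 = y.1 ∧ x.1.2.2 = y.2.2.1 ∧ x.2.1 = y.2.1 ∧ x.2.2.2 = y.2.2.2 then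
      maxEntangled (Cipher m t) (x.1.2.1, x.2.2.1) else 0

/-- The effect `l` of the joint measurement of a half of `|Φ⁺⟩` and the message that teleports
the encryption of the message: with key `k = (k₀, l)` it is the vector
`|C|^(-1/2) ∑ c a, ⟨c| U_k |a, 0^t⟩ ⟨c, a|`. -/
def teleOut (E : Type) [DecidableEq E] (V : K₀ → Matrix.unitaryGroup (Cipher m t) ℂ)
    (k : K₀ × PauliKey m t) : Matrix E (E × (Cipher m t × Bits m)) ℂ :=
  Matrix.of fun e x =>
    if e = x.1 then ((Real.sqrt (Fintype.card (Cipher m t)))⁻¹ : ℝ) * encMat V k x.2.1 x.2.2 else 0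

theorem sqrt_card_cipher_inv_mul_self (m t : ℕ) :
    (((Real.sqrt (Fintype.card (Cipher m t)))⁻¹ : ℝ) : ℂ) *
      ((Real.sqrt (Fintype.card (Cipher m t)))⁻¹ : ℝ) = (Fintype.card (Cipher m t) : ℂ)⁻¹ := by
  rw [← Complex.ofReal_mul, ← mul_inv, Real.mul_self_sqrt (Nat.cast_nonneg _)]
  simp

theorem teleIn_isometry (E : Type) [Fintype E] [DecidableEq E] (m t : ℕ) (R : Type) [Fintype R]
    [DecidableEq R] : (teleIn E m t R)ᴴ * teleIn E m t R = 1 := by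
  have hcard : (Fintype.card (Cipher m t) : ℂ) ≠ 0 := Nat.cast_ne_zero.2 Fintype.card_ne_zero
  ext ⟨e, a₁, a₂, r⟩ ⟨e', a₁', a₂', r'⟩
  have h : ∀ x, (teleIn E m t R)ᴴ (e, (a₁, (a₂, r))) x * teleIn E m t R x (e', (a₁', (a₂', r'))) =
      if x.1.1 = e then if x.1.2.2 = a₂ then if x.2.1 = a₁ then if x.2.2.2 = r then
        if x.2.2.1 = x.1.2.1 then if e = e' ∧ a₁ = a₁' ∧ a₂ = a₂' ∧ r = r' then
          (Fintype.card (Cipher m t) : ℂ)⁻¹ else 0 else 0 else 0 else 0 else 0 else 0 := by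
    -- of all intermediate basis states only those with equal halves `c = c'` contribute
    rintro ⟨⟨e₀, c, b⟩, b₁, c', r₀⟩
    simp only [Matrix.conjTranspose_apply, teleIn, maxEntangled, Matrix.of_apply]
    have hs := sqrt_card_cipher_inv_mul_self m t
    by_cases h1 : e₀ = e
    · by_cases h2 : b = a₂
      · by_cases h3 : b₁ = a₁
        · by_cases h4 : r₀ = r
          · by_cases h5 : c = c'
            · subst h1 h2 h3 h4 h5
              by_cases h6 : e₀ = e' ∧ b = a₂' ∧ b₁ = a₁' ∧ r₀ = r'
              · have h6' : e₀ = e' ∧ b₁ = a₁' ∧ b = a₂' ∧ r₀ = r' := by tauto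
                rw [if_pos h6, if_pos h6', ← hs]
                simp
              · have h6' : ¬(e₀ = e' ∧ b₁ = a₁' ∧ b = a₂' ∧ r₀ = r') := by tauto
                rw [if_neg h6, if_neg h6']
                simp
            · simp [h5, Ne.symm h5]
          · simp [h4]
        · simp [h3]
      · simp [h2]
    · simp [h1]
  rw [Matrix.mul_apply, Finset.sum_congr rfl fun x _ => h x]
  simp only [Fintype.sum_prod_type (α₁ := E × (Cipher m t × Bits m)),
    Fintype.sum_prod_type (α₁ := E), Fintype.sum_prod_type (α₁ := Cipher m t) (α₂ := Bits m),
    Fintype.sum_prod_type (α₁ := Bits m) (α₂ := Cipher m t × R),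
    Fintype.sum_prod_type (α₁ := Cipher m t) (α₂ := R)]
  simp only [Finset.sum_ite_eq', Finset.sum_ite_irrel, Finset.sum_const_zero, Finset.mem_univ,
    if_true, Finset.sum_const, Finset.card_univ]
  simp only [Matrix.one_apply, Prod.mk.injEq]
  split_ifs
  · rw [nsmul_eq_mul, mul_inv_cancel₀ hcard]
  · simp

theorem teleOut_mul_teleIn (E : Type) [Fintype E] [DecidableEq E] (R : Type) [Fintype R]
    [DecidableEq R] (V : K₀ → Matrix.unitaryGroup (Cipher m t) ℂ) (k : K₀ × PauliKey m t) :
    (teleOut E V k ⊗ₖ (1 : Matrix (Bits m × (Cipher m t × R)) (Bits m × (Cipher m t × R)) ℂ)) *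
        teleIn E m t R =
      (Fintype.card (Cipher m t) : ℂ)⁻¹ • ((1 : Matrix E E ℂ) ⊗ₖ
        ((1 : Matrix (Bits m) (Bits m) ℂ) ⊗ₖ (encMat V k ⊗ₖ (1 : Matrix R R ℂ)))) := by
  classical
  ext ⟨e, a₁, c, r⟩ ⟨e', a₁', a₂', r'⟩
  have h : ∀ x : (E × (Cipher m t × Bits m)) × (Bits m × (Cipher m t × R)), (teleOut E V k ⊗ₖ
      (1 : Matrix (Bits m × (Cipher m t × R)) (Bits m × (Cipher m t × R)) ℂ)) (e, (a₁, (c, r))) x *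
        teleIn E m t R x (e', (a₁', (a₂', r'))) =
      if x = ((e, (c, a₂')), (a₁, (c, r))) then (Fintype.card (Cipher m t) : ℂ)⁻¹ *
        (if e = e' ∧ a₁ = a₁' ∧ r = r' then encMat V k c a₂' else 0) else 0 := by
    -- `|Φ⁺⟩` forces the half `c₀` of the environment to agree with the ciphertext `c`
    rintro ⟨⟨e₀, c₀, b⟩, b₁, c', r₀⟩
    have hs := sqrt_card_cipher_inv_mul_self m t
    rw [Matrix.kroneckerMap_apply]
    simp only [teleIn, teleOut, maxEntangled, Matrix.of_apply, Matrix.one_apply, Prod.mk.injEq]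
    by_cases h1 : e = e₀ ∧ a₁ = b₁ ∧ c = c' ∧ r = r₀
    · obtain ⟨rfl, rfl, rfl, rfl⟩ := h1
      by_cases h2 : c₀ = c
      · subst h2
        by_cases h3 : b = a₂'
        · subst h3
          by_cases h4 : e = e' ∧ a₁ = a₁' ∧ r = r'
          · simp only [h4, and_self, if_true, mul_one, ← hs]
            ring
          · have h4' : ¬(e = e' ∧ b = b ∧ a₁ = a₁' ∧ r = r') := by tauto
            rw [if_neg h4, if_neg h4']
            simp
        · simp [h3]
      · simp [h2]
    · have h1' : ¬((e₀ = e ∧ c₀ = c ∧ b = a₂') ∧ b₁ = a₁ ∧ c' = c ∧ r₀ = r) := by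
        rintro ⟨⟨rfl, -, -⟩, rfl, rfl, rfl⟩
        exact h1 ⟨rfl, rfl, rfl, rfl⟩
      rw [if_neg h1']
      by_cases h5 : e = e₀
      · have : ¬(a₁ = b₁ ∧ c = c' ∧ r = r₀) := fun h => h1 ⟨h5, h⟩
        rw [if_neg this, mul_zero, zero_mul]
      · rw [if_neg h5, zero_mul, zero_mul]
  rw [Matrix.mul_apply, Finset.sum_congr rfl fun x _ => h x]
  simp only [Finset.sum_ite_eq', Finset.mem_univ, if_true, Matrix.smul_apply, smul_eq_mul,
    Matrix.kroneckerMap_apply, Matrix.one_apply]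
  congr 1
  by_cases h1 : e = e' <;> by_cases h2 : a₁ = a₁' <;> by_cases h3 : r = r' <;> simp [h1, h2, h3]

/-- The effects `teleOut` form a measurement. -/
theorem sum_teleOut (E : Type) [Fintype E] [DecidableEq E]
    (V : K₀ → Matrix.unitaryGroup (Cipher m t) ℂ) (k₀ : K₀) :
    ∑ l : PauliKey m t, (teleOut E V (k₀, l))ᴴ * teleOut E V (k₀, l) = 1 := by
  have hcard : (Fintype.card (Cipher m t) : ℂ) ≠ 0 := Nat.cast_ne_zero.2 Fintype.card_ne_zero
  ext ⟨e, c, a⟩ ⟨e', c', a'⟩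
  have h : ∀ l : PauliKey m t, ((teleOut E V (k₀, l))ᴴ * teleOut E V (k₀, l)) (e, (c, a))
      (e', (c', a')) = if e = e' then (Fintype.card (Cipher m t) : ℂ)⁻¹ *
        (star (encMat V (k₀, l) c a) * encMat V (k₀, l) c' a') else 0 := by
    intro l
    rw [Matrix.mul_apply]
    simp only [teleOut, Matrix.conjTranspose_apply, Matrix.of_apply, apply_ite star, star_zero,
      ite_mul, zero_mul, Finset.sum_ite_eq', Finset.mem_univ, if_true, mul_ite, mul_zero]
    refine if_congr eq_comm ?_ rfl
    rw [star_mul', ← sqrt_card_cipher_inv_mul_self, mul_mul_mul_comm]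
    congr 2
    exact Complex.conj_ofReal _
  rw [Matrix.sum_apply, Finset.sum_congr rfl fun l _ => h l]
  simp only [Finset.sum_ite_irrel, Finset.sum_const_zero, ← Finset.mul_sum,
    sum_star_encMat_mul_encMat, Matrix.one_apply, Prod.mk.injEq]
  by_cases h1 : e = e' <;> by_cases h2 : c = c' <;> by_cases h3 : a = a' <;>
    simp [h1, h2, h3, -Fintype.card_prod, -Fintype.card_pi, hcard]

theorem card_pauliKey (m t : ℕ) : (Fintype.card (PauliKey m t) : ℂ) =
    Fintype.card (Cipher m t) * Fintype.card (Cipher m t) := by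
  simp only [Fintype.card_prod, Nat.cast_mul]
  ring

/-- Teleportation: the effect with key `k` turns the maximally entangled state and `M₂` into the
encryption of `M₂` under `k`, with a probability that does not depend on the state. -/
theorem conj_teleOut_conj_teleIn (E : Type) [Fintype E] [DecidableEq E] (R : Type) [Fintype R]
    [DecidableEq R] (V : K₀ → Matrix.unitaryGroup (Cipher m t) ℂ) (k : K₀ × PauliKey m t)
    (ρ : Matrix (E × (Bits m × (Bits m × R))) (E × (Bits m × (Bits m × R))) ℂ) :
    conj (teleOut E V k ⊗ₖ
        (1 : Matrix (Bits m × (Cipher m t × R)) (Bits m × (Cipher m t × R)) ℂ))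
        (conj (teleIn E m t R) ρ) =
      (Fintype.card (PauliKey m t) : ℂ)⁻¹ •
        idTensor E (idTensor (Bits m) (tensorId ((canonicalScheme V).encrypt k) R)) ρ := by
  rw [← LinearMap.comp_apply, conj_comp, teleOut_mul_teleIn, conj_smul, card_pauliKey,
    encrypt_canonicalScheme, tensorId_conj, idTensor_conj, idTensor_conj, mul_inv]
  rw [show star (Fintype.card (Cipher m t) : ℂ)⁻¹ = (Fintype.card (Cipher m t) : ℂ)⁻¹ by simp]
  rfl

/-- The readout of the value `z` of a classical register. -/
def readout (B : Type) {Z : Type} [DecidableEq B] [DecidableEq Z] (z : Z) : Matrix B (B × Z) ℂ :=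
  Matrix.of fun b x => if b = x.1 ∧ x.2 = z then 1 else 0

theorem sum_readout (B Z : Type) [Fintype B] [DecidableEq B] [Fintype Z] [DecidableEq Z] :
    ∑ z : Z, (readout B z)ᴴ * readout B z = 1 := by
  ext ⟨b, z⟩ ⟨b', z'⟩
  simp only [Matrix.sum_apply, Matrix.mul_apply, Matrix.conjTranspose_apply, readout,
    Matrix.of_apply, Matrix.one_apply, ite_and, apply_ite star, star_one, star_zero, ite_mul,
    one_mul, zero_mul, Finset.sum_ite_eq, Finset.mem_univ, if_true, Prod.mk.injEq, eq_comm]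

theorem conj_readout_comp_append (B : Type) {Z : Type} [Fintype B] [DecidableEq B] [Fintype Z]
    [DecidableEq Z] (z z' : Z) : (conj (readout B z)).comp (append B (Matrix.single z' z' 1)) =
      if z = z' then LinearMap.id else 0 := by
  ext X b b'
  change (readout B z * (X ⊗ₖ Matrix.single z' z' (1 : ℂ)) * (readout B z)ᴴ) b b' = _
  simp only [Matrix.mul_apply, Matrix.conjTranspose_apply, readout, Matrix.of_apply,
    Fintype.sum_prod_type, Matrix.kroneckerMap_apply, Matrix.single_apply, ite_and, ite_mul,
    one_mul, zero_mul, mul_ite, mul_one, mul_zero, apply_ite star, star_one, star_zero,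
    Finset.sum_ite_eq, Finset.mem_univ, if_true]
  by_cases h : z = z'
  · subst h
    simp
  · simp [h, Ne.symm h]

end Teleport

/-! ### The reduction to a single message -/

section Reduction

variable {m t : ℕ} {K₀ : Type} [Fintype K₀] [DecidableEq K₀]

/-- The code key, which is revealed on accept as well as on reject. -/
def codeKey {P : Type} : (K₀ × P) ⊕ K₀ → K₀ := Sum.elim Prod.fst id

/-- Read the code key `k₀`, teleport the encryption of `M₂` into the second ciphertext, with the
measurement outcome `l` as its Pauli key, and apply `Q k₀ l`. -/
def teleport (E : Type) [Fintype E] [DecidableEq E] (V : K₀ → Matrix.unitaryGroup (Cipher m t) ℂ)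
    {B D : Type} [Fintype B] [DecidableEq B] (Q : K₀ → PauliKey m t → SuperOp B D) :
    SuperOp ((E × (Cipher m t × Bits m)) × (B × ((K₀ × PauliKey m t) ⊕ K₀))) (E × D) :=
  ∑ z, ∑ l, (idTensor E (Q (codeKey z) l)).comp
    (conj (teleOut E V (codeKey z, l) ⊗ₖ readout B z))

variable {E : Type} [Fintype E] [DecidableEq E] (V : K₀ → Matrix.unitaryGroup (Cipher m t) ℂ)
  {B D : Type} [Fintype B] [DecidableEq B] {Q : K₀ → PauliKey m t → SuperOp B D}

theorem isCP_teleport (hQ : ∀ k₀ l, (Q k₀ l).IsCP) : IsCP (teleport E V Q) :=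
  SuperOp.IsCP.sum _ fun _ => SuperOp.IsCP.sum _ fun l => (hQ _ l).idTensor.comp (isCP_conj _)

set_option synthInstance.maxSize 1000 in
theorem isTP_teleport [Fintype D] (hQ : ∀ k₀ l, (Q k₀ l).IsTP) : IsTP (teleport E V Q) := by
  intro X
  have h : ∀ (z : (K₀ × PauliKey m t) ⊕ K₀) (l : PauliKey m t),
      (idTensor E (Q (codeKey z) l) (conj (teleOut E V (codeKey z, l) ⊗ₖ readout B z) X)).trace =
        ((((teleOut E V (codeKey z, l))ᴴ * teleOut E V (codeKey z, l)) ⊗ₖ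
          ((readout B z)ᴴ * readout B z)) * X).trace := by
    intro z l
    rw [(hQ _ l).idTensor, trace_conj, Matrix.conjTranspose_kronecker, ← Matrix.mul_kronecker_mul]
  have hsum : ∑ z : (K₀ × PauliKey m t) ⊕ K₀, ∑ l : PauliKey m t,
      ((teleOut E V (codeKey z, l))ᴴ * teleOut E V (codeKey z, l)) ⊗ₖ
        ((readout B z)ᴴ * readout B z) = 1 := by
    calc _ = ∑ z : (K₀ × PauliKey m t) ⊕ K₀, (1 : Matrix (E × (Cipher m t × Bits m)) _ ℂ) ⊗ₖ
          ((readout B z)ᴴ * readout B z) := by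
          refine Finset.sum_congr rfl fun z _ => ?_
          rw [← sum_teleOut E V (codeKey z)]
          ext i j
          simp only [Matrix.sum_apply, Matrix.kroneckerMap_apply, Finset.sum_mul]
      _ = (1 : Matrix (E × (Cipher m t × Bits m)) _ ℂ) ⊗ₖ
          ∑ z : (K₀ × PauliKey m t) ⊕ K₀, (readout B z)ᴴ * readout B z := by
          ext i j
          simp only [Matrix.sum_apply, Matrix.kroneckerMap_apply, Finset.mul_sum]
      _ = 1 := by rw [sum_readout, Matrix.one_kronecker_one]
  simp only [teleport, LinearMap.sum_apply, LinearMap.comp_apply, Matrix.trace_sum, h]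
  simp only [← Matrix.trace_sum, ← Finset.sum_mul, hsum, Matrix.one_mul]


theorem teleport_append {R : Type} [Fintype R] [DecidableEq R]
    (Q : K₀ → PauliKey m t → SuperOp B D) (z : (K₀ × PauliKey m t) ⊕ K₀)
    (G : SuperOp (Bits m × (Cipher m t × R)) B)
    (ρ : Matrix (E × (Bits m × (Bits m × R))) (E × (Bits m × (Bits m × R))) ℂ) :
    teleport E V Q (idTensor (E × (Cipher m t × Bits m))
        ((append B (Matrix.single z z 1)).comp G) (conj (teleIn E m t R) ρ)) =
      (Fintype.card (PauliKey m t) : ℂ)⁻¹ • ∑ l, idTensor E ((Q (codeKey z) l).comp (G.comp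
        (idTensor (Bits m) (tensorId ((canonicalScheme V).encrypt (codeKey z, l)) R)))) ρ := by
  simp only [teleport, LinearMap.sum_apply, LinearMap.comp_apply]
  rw [Finset.sum_eq_single z, Finset.smul_sum]
  · refine Finset.sum_congr rfl fun l _ => ?_
    rw [conj_kronecker_idTensor, ← LinearMap.comp_assoc, conj_readout_comp_append, if_pos rfl,
      LinearMap.id_comp, conj_teleOut_conj_teleIn, LinearMap.map_smul, LinearMap.map_smul]
    rfl
  · intro z' _ hz'
    refine Finset.sum_eq_zero fun l _ => ?_
    rw [conj_kronecker_idTensor, ← LinearMap.comp_assoc, conj_readout_comp_append, if_neg hz',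
      LinearMap.zero_comp]
    exact LinearMap.map_zero _
  · exact fun h => absurd (Finset.mem_univ z) h

/-- Teleportation turns a keyed channel on the half `C₂` of a maximally entangled state into the
same channel on the encryption of `M₂`, with a fresh Pauli key, under the same code key. -/
theorem teleport_keyed {R : Type} [Fintype R] [DecidableEq R]
    (Q : K₀ → PauliKey m t → SuperOp B D)
    (Φ Ψ : K₀ × PauliKey m t → SuperOp (Bits m × (Cipher m t × R)) B)
    (ρ : Matrix (E × (Bits m × (Bits m × R))) (E × (Bits m × (Bits m × R))) ℂ) :
    teleport E V Q (idTensor (E × (Cipher m t × Bits m)) (EncScheme.keyed Prod.fst Φ Ψ)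
        (conj (teleIn E m t R) ρ)) =
      idTensor E ((Fintype.card (K₀ × PauliKey m t) : ℂ)⁻¹ • ∑ k : K₀ × PauliKey m t,
        (Fintype.card (PauliKey m t) : ℂ)⁻¹ • ∑ l, (Q k.1 l).comp ((Φ k + Ψ k).comp
          (idTensor (Bits m) (tensorId ((canonicalScheme V).encrypt (k.1, l)) R)))) ρ := by
  simp only [EncScheme.keyed, idTensor_smul, idTensor_sum, idTensor_add, LinearMap.smul_apply,
    LinearMap.sum_apply, LinearMap.add_apply, map_smul, map_sum, map_add, teleport_append]
  congr 1
  refine Finset.sum_congr rfl fun k _ => ?_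
  rw [← smul_add, ← Finset.sum_add_distrib]
  congr 1
  refine Finset.sum_congr rfl fun l _ => ?_
  rw [LinearMap.add_comp, LinearMap.comp_add, idTensor_add]
  rfl

section Parallel

variable {R R₁ R₂ : Type}

/-- The second adversary and the second decryption, with the keys revealed. -/
def secondRound (𝒜₂ : SuperOp (Option (Bits m) × (Cipher m t × R₁)) (Cipher m t × R₂))
    (k₀ : K₀) (l : PauliKey m t) : SuperOp (Option (Bits m) × (Cipher m t × R₁))
      ((Option (Bits m) × R₂) × ((K₀ × PauliKey m t) ⊕ K₀)) :=
  (append _ (Matrix.single (Sum.inl (k₀, l)) (Sum.inl (k₀, l)) 1)).comp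
      ((tensorId ((canonicalScheme V).decryptAcc (k₀, l)) R₂).comp 𝒜₂) +
    (append _ (Matrix.single (Sum.inr k₀) (Sum.inr k₀) 1)).comp
      ((tensorId ((canonicalScheme V).decryptRej (k₀, l)) R₂).comp 𝒜₂)

variable {V}

theorem isCP_secondRound [Fintype R₂]
    {𝒜₂ : SuperOp (Option (Bits m) × (Cipher m t × R₁)) (Cipher m t × R₂)} (h𝒜₂ : 𝒜₂.IsCP)
    (k₀ : K₀) (l : PauliKey m t) : IsCP (secondRound V 𝒜₂ k₀ l) :=
  ((isCP_append (posSemidef_single _)).comp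
      (((canonicalScheme V).isCP_decryptAcc _).tensorId.comp h𝒜₂)).add
    ((isCP_append (posSemidef_single _)).comp
      (((canonicalScheme V).isCP_decryptRej _).tensorId.comp h𝒜₂))

theorem isTP_secondRound [Fintype R₁] [Fintype R₂]
    {𝒜₂ : SuperOp (Option (Bits m) × (Cipher m t × R₁)) (Cipher m t × R₂)} (h𝒜₂ : 𝒜₂.IsTP)
    (k₀ : K₀) (l : PauliKey m t) : IsTP (secondRound V 𝒜₂ k₀ l) := by
  intro X
  rw [secondRound, LinearMap.add_apply, Matrix.trace_add]
  simp only [LinearMap.comp_apply]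
  rw [isTP_append (trace_single_self _), isTP_append (trace_single_self _), ← Matrix.trace_add,
    ← LinearMap.add_apply, ← tensorId_add]
  exact ((isTP_decrypt_canonicalScheme V (k₀, l)).tensorId _).trans (h𝒜₂ X)

/-- The two-message channel in the form in which `teleport_keyed` produces it from the real channel
of the first message. -/
theorem parallelReal_eq [Fintype R]
    (𝒜₁ : SuperOp (Cipher m t × (Cipher m t × R)) (Cipher m t × (Cipher m t × R₁)))
    (𝒜₂ : SuperOp (Option (Bits m) × (Cipher m t × R₁)) (Cipher m t × R₂)) :
    parallelReal V 𝒜₁ 𝒜₂ = (Fintype.card (K₀ × PauliKey m t) : ℂ)⁻¹ •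
      ∑ k : K₀ × PauliKey m t, (Fintype.card (PauliKey m t) : ℂ)⁻¹ • ∑ l,
        (secondRound V 𝒜₂ k.1 l).comp
          (((tensorId ((canonicalScheme V).decryptAcc k) (Cipher m t × R₁)).comp
              (𝒜₁.comp (tensorId ((canonicalScheme V).encrypt k) (Cipher m t × R))) +
            (tensorId ((canonicalScheme V).decryptRej k) (Cipher m t × R₁)).comp
              (𝒜₁.comp (tensorId ((canonicalScheme V).encrypt k) (Cipher m t × R)))).comp
            (idTensor (Bits m) (tensorId ((canonicalScheme V).encrypt (k.1, l)) R))) := by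
  have hcard : (Fintype.card (K₀ × PauliKey m t × PauliKey m t) : ℂ)⁻¹ =
      (Fintype.card (K₀ × PauliKey m t) : ℂ)⁻¹ * (Fintype.card (PauliKey m t) : ℂ)⁻¹ := by
    rw [← mul_inv, ← Nat.cast_mul, ← Fintype.card_prod,
      Fintype.card_congr (Equiv.prodAssoc K₀ (PauliKey m t) (PauliKey m t))]
  rw [parallelReal, ← Finset.smul_sum, smul_smul, hcard, Fintype.sum_prod_type]
  refine congrArg (_ • ·) ?_
  refine Finset.sum_congr rfl fun k₀ _ => ?_
  refine Finset.sum_congr rfl fun k₁ _ => ?_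
  refine Finset.sum_congr rfl fun k₂ _ => ?_
  have hacc : ∀ Y, tensorId (projAcc (Bits m)) R₂
      (tensorId ((canonicalScheme V).decrypt (k₀, k₂)) R₂ Y) =
        tensorId ((canonicalScheme V).decryptAcc (k₀, k₂)) R₂ Y := fun Y => by
    rw [← LinearMap.comp_apply, ← tensorId_comp, EncScheme.projAcc_comp_decrypt]
  have hrej : ∀ Y, tensorId (projRej (Bits m)) R₂
      (tensorId ((canonicalScheme V).decrypt (k₀, k₂)) R₂ Y) =
        tensorId ((canonicalScheme V).decryptRej (k₀, k₂)) R₂ Y := fun Y => by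
    rw [← LinearMap.comp_apply, ← tensorId_comp, EncScheme.projRej_comp_decrypt]
  ext1 X
  rw [parallelRealKeyed, tensor_eq_tensorId_comp_idTensor, secondRound]
  simp only [LinearMap.comp_apply, LinearMap.add_apply, hacc, hrej]
  rw [show (canonicalScheme V).decrypt (k₀, k₁) = (canonicalScheme V).decryptAcc (k₀, k₁) +
    (canonicalScheme V).decryptRej (k₀, k₁) from rfl, tensorId_add, LinearMap.add_apply]

/-- The real channel of the second message in the form in which `teleport_keyed` produces it from the
ideal channel of the first message; the sum over the Pauli key of the first message is trivial. -/
theorem real_secondAdversary_comp_relabel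
    (𝒜₂ : SuperOp (Option (Bits m) × (Cipher m t × R₁)) (Cipher m t × R₂))
    (Sacc Srej : SuperOp (Cipher m t × R) (Cipher m t × R₁)) :
    ((canonicalScheme V).real Prod.fst (secondAdversary 𝒜₂ Sacc Srej)).comp
        (relabel (exchange (Bits m) (Bits m) R)) =
      (Fintype.card (K₀ × PauliKey m t) : ℂ)⁻¹ •
        ∑ k : K₀ × PauliKey m t, (Fintype.card (PauliKey m t) : ℂ)⁻¹ • ∑ l,
          (secondRound V 𝒜₂ k.1 l).comp
            ((tensor (accEmbed (Bits m)) Sacc + tensor (rejEmbed (Bits m)) Srej).comp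
              (idTensor (Bits m) (tensorId ((canonicalScheme V).encrypt (k.1, l)) R))) := by
  have hcard : (Fintype.card (PauliKey m t) : ℂ) ≠ 0 := Nat.cast_ne_zero.2 Fintype.card_ne_zero
  rw [EncScheme.real, LinearMap.smul_comp]
  congr 1
  rw [Fintype.sum_prod_type, Fintype.sum_prod_type]
  ext1 X
  simp only [LinearMap.comp_apply, LinearMap.sum_apply]
  refine Finset.sum_congr rfl fun k₀ _ => ?_
  rw [Finset.sum_const, Finset.card_univ, ← Nat.cast_smul_eq_nsmul ℂ]
  simp only [LinearMap.smul_apply, LinearMap.sum_apply]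
  rw [smul_smul, mul_inv_cancel₀ hcard, one_smul]
  exact Finset.sum_congr rfl fun l _ => rfl

theorem isChannel_secondAdversary [Fintype R] [Fintype R₁] [Fintype R₂]
    {𝒜₂ : SuperOp (Option (Bits m) × (Cipher m t × R₁)) (Cipher m t × R₂)} (h𝒜₂ : 𝒜₂.IsChannel)
    {Sacc Srej : SuperOp (Cipher m t × R) (Cipher m t × R₁)} (hacc : Sacc.IsCP)
    (hrej : Srej.IsCP) (h : IsTP (Sacc + Srej)) :
    IsChannel (secondAdversary 𝒜₂ Sacc Srej) :=
  ⟨h𝒜₂.1.comp <| (((isCP_accEmbed _).tensor hacc).add ((isCP_rejEmbed _).tensor hrej)).comp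
      (isCP_relabel _),
    h𝒜₂.2.comp <| (isTP_tensor_add_tensor (isTP_accEmbed _) (isTP_rejEmbed _) h).comp
      (isTP_relabel _)⟩

theorem isDensity_conj {A A' : Type} [Fintype A] [DecidableEq A] [Fintype A'] {K : Matrix A' A ℂ}
    (hK : Kᴴ * K = 1) {ρ : Matrix A A ℂ} (hρ : IsDensity ρ) : IsDensity (conj K ρ) :=
  ⟨hρ.1.mul_mul_conjTranspose_same K, (isTP_conj hK ρ).trans hρ.2⟩

set_option synthInstance.maxSize 1000 in
/-- Replacing the transmission of the first message by its simulation costs at most the distance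
between the real and the ideal channel of the first message. -/
theorem diamondDist_parallelReal_le [Fintype R] [DecidableEq R] [Fintype R₁] [DecidableEq R₁]
    [Fintype R₂] [DecidableEq R₂]
    {𝒜₁ : SuperOp (Cipher m t × (Cipher m t × R)) (Cipher m t × (Cipher m t × R₁))}
    (h𝒜₁ : 𝒜₁.IsCP) {𝒜₂ : SuperOp (Option (Bits m) × (Cipher m t × R₁)) (Cipher m t × R₂)}
    (h𝒜₂ : 𝒜₂.IsChannel) {Sacc Srej : SuperOp (Cipher m t × R) (Cipher m t × R₁)}
    (hacc : Sacc.IsCP) (hrej : Srej.IsCP) :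
    diamondDist (parallelReal V 𝒜₁ 𝒜₂)
        (((canonicalScheme V).real Prod.fst (secondAdversary 𝒜₂ Sacc Srej)).comp
          (relabel (exchange (Bits m) (Bits m) R))) ≤
      diamondDist ((canonicalScheme V).real Prod.fst 𝒜₁)
        (EncScheme.ideal Prod.fst (Bits m) Sacc Srej) := by
  refine diamondDist_le_of_simulation (EncScheme.isCP_real _ _ h𝒜₁)
    (EncScheme.isCP_ideal _ hacc hrej) fun E _ _ ρ hρ => ?_
  refine ⟨E × (Cipher m t × Bits m), inferInstance, inferInstance, conj (teleIn E m t R) ρ,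
    teleport E V (secondRound V 𝒜₂), isDensity_conj (teleIn_isometry E m t R) hρ,
    fun X hX => (isCP_teleport V (isCP_secondRound h𝒜₂.1)).posSemidef_apply hX,
    isTP_teleport V (isTP_secondRound h𝒜₂.2), ?_, ?_⟩
  · rw [EncScheme.real_eq_keyed, teleport_keyed, parallelReal_eq]
  · rw [EncScheme.ideal_eq_keyed, teleport_keyed, real_secondAdversary_comp_relabel]

/-- The diamond distance does not increase under a relabelling of the input. -/
theorem diamondDist_comp_relabel_le {A A' B' : Type} [Fintype A] [Fintype A'] [Fintype B']
    [DecidableEq B'] {Φ Ψ : SuperOp A' B'} (hΦ : Φ.IsCP) (hΨ : Ψ.IsCP) (e : A ≃ A') :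
    diamondDist (Φ.comp (relabel e)) (Ψ.comp (relabel e)) ≤ diamondDist Φ Ψ :=
  diamondDist_le_of_simulation hΦ hΨ fun E _ _ ρ hρ =>
    ⟨E, inferInstance, inferInstance, idTensor E (relabel e) ρ, LinearMap.id,
      ⟨isCP_relabel e E ρ hρ.1, ((isTP_relabel e).idTensor ρ).trans hρ.2⟩, fun _ h => h,
      fun _ => rfl, rfl, rfl⟩

end Parallel

end Reduction

end QAuth

end

theorem mainTheorem4 (m t : ℕ) (K₀ : Type) [Fintype K₀] [DecidableEq K₀] [Nonempty K₀]
    (V : K₀ → Matrix.unitaryGroup (Cipher m t) ℂ)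
    (hV : IsPauliCode V) (δ : ℝ) (hδ : IsStrongPurityTesting V δ)
    (ε : ℝ≥0) (hε : (canonicalScheme V).QCAR Prod.fst ε)
    (R R₁ : Type) [Fintype R] [DecidableEq R] [Fintype R₁] [DecidableEq R₁]
    (𝒜₁ : SuperOp (Cipher m t × (Cipher m t × R)) (Cipher m t × (Cipher m t × R₁)))
    (h𝒜₁ : 𝒜₁.IsChannel) :
    ∃ Srej₁ : SuperOp (Cipher m t × R) (Cipher m t × R₁),
      (canonicalScheme V).IsRejSim Prod.fst ε 𝒜₁ Srej₁ ∧
      ∀ (R₂ : Type) [Fintype R₂] [DecidableEq R₂]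
        (𝒜₂ : SuperOp (Option (Bits m) × (Cipher m t × R₁)) (Cipher m t × R₂)),
        𝒜₂.IsChannel →
        ∃ Srej : SuperOp (Bits m × R) R₂,
          Srej.IsCP ∧
          SuperOp.IsTP ((canonicalScheme V).accSim
            (secondAdversary 𝒜₂ ((canonicalScheme V).accSim 𝒜₁) Srej₁) + Srej) ∧
          diamondDist (parallelReal V 𝒜₁ 𝒜₂)
            (parallelIdeal K₀ m t ((canonicalScheme V).accSim
              (secondAdversary 𝒜₂ ((canonicalScheme V).accSim 𝒜₁) Srej₁)) Srej) ≤ 2 * ε := by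
  obtain ⟨Srej₁, hcp₁, htp₁, hdist₁⟩ := hε _ _ 𝒜₁ h𝒜₁
  refine ⟨Srej₁, ⟨hcp₁, htp₁, hdist₁⟩, fun R₂ _ _ 𝒜₂ h𝒜₂ => ?_⟩
  have hacc₁ := (canonicalScheme V).isCP_accSim h𝒜₁.1
  have h𝒜' := isChannel_secondAdversary h𝒜₂ hacc₁ hcp₁ htp₁
  obtain ⟨Srej, hcp, htp, hdist⟩ := hε _ _ _ h𝒜'
  refine ⟨Srej, hcp, htp, ?_⟩
  have hreal := EncScheme.isCP_real (canonicalScheme V) Prod.fst h𝒜'.1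
  have hideal := EncScheme.isCP_ideal (M := Bits m) (Prod.fst : K₀ × PauliKey m t → K₀)
    ((canonicalScheme V).isCP_accSim h𝒜'.1) hcp
  have hparallel : (parallelReal V 𝒜₁ 𝒜₂).IsCP := by
    rw [parallelReal_eq]
    refine (SuperOp.IsCP.sum _ fun k => (SuperOp.IsCP.sum _ fun l => ?_).smul
      (EncScheme.inv_card_nonneg _)).smul (EncScheme.inv_card_nonneg _)
    have henc := fun k => (canonicalScheme V).isCP_encrypt k
    refine (isCP_secondRound h𝒜₂.1 _ _).comp (SuperOp.IsCP.comp ?_ (henc _).tensorId.idTensor)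
    exact (((canonicalScheme V).isCP_decryptAcc k).tensorId.comp
        (h𝒜₁.1.comp (henc k).tensorId)).add
      (((canonicalScheme V).isCP_decryptRej k).tensorId.comp (h𝒜₁.1.comp (henc k).tensorId))
  calc diamondDist (parallelReal V 𝒜₁ 𝒜₂) _
      ≤ _ := diamondDist_triangle hparallel (hreal.comp (isCP_relabel _))
        (hideal.comp (isCP_relabel _))
    _ ≤ ε + ε := add_le_add
        ((diamondDist_parallelReal_le h𝒜₁.1 h𝒜₂ hacc₁ hcp₁).trans hdist₁)
        ((diamondDist_comp_relabel_le hreal hideal _).trans hdist)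
    _ = 2 * ε := (two_mul _).symm
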